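/- Let $(D,\mathcal A,\mu)$ be an arbitrary measure space, $\mathbb K\in\{\mathbb R,\mathbb C\}$ and $L^2=L^2(D,\mathcal A,\mu)$ the space of square-integrable $\mathbb K$-valued functions with norm $\|\cdot\|_2$. Let $F$ be a Hilbert space over $\mathbb K$ of measurable functions $f:D\to\mathbb K$ (with pointwise vector space operations) which is contained in $L^2$, such that the embedding $T:F\to L^2$, $Tf=f$, is injective and compact. (Point evaluations need not be continuous on $F$. If $F$ is given as a space of $\mu$-equivalence classes, fix any choice of measurable representatives that is linear in $f$.) For $n\ge 1$ let $\sigma(n)$ be the $n$-th singular value of $T$, i.e. the square root of the $n$-th largest eigenvalue of $T^*T$, counted with multiplicity, with $\sigma(n)=0$ for $n>\dim F$. A deterministic algorithm $A:F\to L^2$ from the class $\Lambda^{\rm all}$ (respectively $\Lambda^{\rm std}$) with at most $n$ evaluations successively evaluates at most $n$ linear functionals of the input $f$ (respectively at most $n$ function values $f(x)$, $x\in D$), where each choice of a functional, the decision to stop, and the output in $L^2$ may depend in an arbitrary way on the values observed before. Its error is $e^{\rm det}(A)=\sup_{\|f\|_F\le1}\|f-A(f)\|_2$. A randomized algorithm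 from the class $\Lambda$ with at most $n$ evaluations is a family $(A^\omega)_{\omega\in\Omega}$ of such deterministic algorithms, indexed by a probability space $\Omega$, which is measurable in the following sense: the map $(f,\omega)\mapsto A^\omega(f)\in L^2$ is jointly Borel measurable on $V\times\Omega$ for each linear subspace $V\subset F$ on which all point evaluations are continuous (thus on $F\times\Omega$, if all point evaluations are continuous on $F$). Its error is $e^{\rm ran}(A)=\sup_{\|f\|_F\le1}\big(\mathbb E_\omega\|f-A^\omega(f)\|_2^2\big)^{1/2}$. Let $e^{\rm det}(n,T,\Lambda)$ and $e^{\rm ran}(n,T,\Lambda)$ denote the infimum of the errors of all deterministic, respectively measurable randomized, algorithms from the class $\Lambda$ with at most $n$ evaluations. For sequences in $[0,\infty)$ write $x_n\preccurlyeq y_n$ if there are $C>0$ and $n_0\in\mathbb N$ with $x_n\le C y_n$ for all $n\ge n_0$, and $x_n\asymp y_n$ if $x_n\preccurlyeq y_n$ and $y_n\preccurlyeq x_n$. If $\sigma(2n)\asymp\sigma(n)$, then $$e^{\rm ran}(n,T,\Lambda^{\rm std})\asymp e^{\rm ran}(n,T,\Lambda^{\rm all})\asymp e^{\rm det}(n,T,\Lambda^{\rm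 all}).$$ -/

import Mathlib

open MeasureTheory
open scoped ENNReal NNReal

universe u v w

noncomputable section

/-! ### Order of convergence -/

/-- `x n ≼ y n`: there are `C > 0` and `n₀` with `x n ≤ C * y n` for all `n ≥ n₀`. -/
def OrderLE (x y : ℕ → ℝ≥0∞) : Prop :=
  ∃ C : ℝ≥0, 0 < C ∧ ∃ n₀ : ℕ, ∀ n ≥ n₀, x n ≤ (C : ℝ≥0∞) * y n

/-- `x n ≍ y n`: both `x n ≼ y n` and `y n ≼ x n`. -/
def SameOrder (x y : ℕ → ℝ≥0∞) : Prop := OrderLE x y ∧ OrderLE y x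

/-! ### Singular values -/

/-- The `n`-th largest eigenvalue (`n ≥ 1`, counted with multiplicity) of a positive semi-definite
compact operator `W`: the largest `t ≥ 0` such that there are `n` orthonormal eigenvectors of `W`
with eigenvalues at least `t`, and `0` if there are no `n` orthonormal eigenvectors.
(The value at `n = 0` has no meaning.) -/
def nthEigenvalue {K : Type w} [RCLike K] {F : Type v} [NormedAddCommGroup F]
    [InnerProductSpace K F] (W : F →L[K] F) (n : ℕ) : ℝ :=
  sSup {t : ℝ | 0 ≤ t ∧ ∃ e : Fin n → F, Orthonormal K e ∧
    ∀ i, ∃ s : ℝ, t ≤ s ∧ W (e i) = (s : K) • e i}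

/-- The `n`-th singular value `σ(n)` (`n ≥ 1`) of a compact operator `T` between Hilbert spaces:
the square root of the `n`-th largest eigenvalue of `T* T`. -/
def nthSingularValue {K : Type w} [RCLike K] {F G : Type*}
    [NormedAddCommGroup F] [InnerProductSpace K F] [CompleteSpace F]
    [NormedAddCommGroup G] [InnerProductSpace K G] [CompleteSpace G]
    (T : F →L[K] G) (n : ℕ) : ℝ :=
  Real.sqrt (nthEigenvalue ((ContinuousLinearMap.adjoint T).comp T) n)

/-! ### Algorithms -/

/-- `IsDetAlg Λ n A`: the map `A` is a deterministic algorithm that evaluates at most `n`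
functionals from the class `Λ` at its input. Either no evaluation is made and the output is fixed,
or a functional `L ∈ Λ` is evaluated at the input `f` and the algorithm proceeds with a
deterministic algorithm `B (L f)` that makes at most `n - 1` further evaluations and may depend
on the value `L f` in an arbitrary way. -/
inductive IsDetAlg {K : Type w} [RCLike K] {F G : Type*} [AddCommGroup F] [Module K F]
    (Λ : Set (F →ₗ[K] K)) : ℕ → (F → G) → Prop
  | const (n : ℕ) (g : G) : IsDetAlg Λ n (fun _ => g)
  | query (n : ℕ) (L : F →ₗ[K] K) (hL : L ∈ Λ) (B : K → F → G)
      (hB : ∀ y : K, IsDetAlg Λ n (B y)) : IsDetAlg Λ (n + 1) (fun f => B (L f) f)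

/-- `Λ^all`: arbitrary linear functionals. -/
def lambdaAll (K : Type w) [RCLike K] (F : Type v) [AddCommGroup F] [Module K F] :
    Set (F →ₗ[K] K) := Set.univ

/-- `Λ^std`: the function values `f ↦ f(x)` for `x ∈ D`.
Here `ev f : D → K` is the element `f` of `F` as a function. -/
def lambdaStd {D : Type u} {K : Type w} [RCLike K] {F : Type v} [AddCommGroup F] [Module K F]
    (ev : F →ₗ[K] (D → K)) : Set (F →ₗ[K] K) :=
  {L | ∃ x : D, ∀ f : F, L f = ev f x}

/-- Measurability of a randomized map `(f, ω) ↦ A ω f`: joint Borel measurability on `V × Ω` for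
each subspace `V` of `F` on which all point evaluations are continuous.
If all point evaluations are continuous on `F`, this is just joint Borel measurability on `F × Ω`.
In general, all finite-dimensional subspaces are among the `V`, while the
evaluation of `f` at a random point need not be jointly Borel measurable on `F × Ω`. -/
def IsMeasurableRandomized {D : Type u} {K : Type w} [RCLike K] {F G : Type*}
    [NormedAddCommGroup F] [InnerProductSpace K F] [TopologicalSpace G]
    (ev : F →ₗ[K] (D → K)) {Ω : Type u} (mΩ : MeasurableSpace Ω) (A : Ω → F → G) : Prop :=
  ∀ V : Submodule K F, (∀ x : D, Continuous fun f : V => ev (f : F) x) →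
    @Measurable (V × Ω) G (@Prod.instMeasurableSpace V Ω (borel V) mΩ) (borel G)
      (fun p => A p.2 (p.1 : F))

/-- Measurable randomized algorithms `F × Ω → G` on some probability space `Ω` that evaluate at
most `n` functionals from the class `Λ`. -/
structure RandomizedAlg {D : Type u} {K : Type w} [RCLike K] {F : Type v} (G : Type*)
    [NormedAddCommGroup F] [InnerProductSpace K F] [TopologicalSpace G]
    (ev : F →ₗ[K] (D → K)) (Λ : Set (F →ₗ[K] K)) (n : ℕ) where
  /-- the sample space -/
  Ω : Type u
  mΩ : MeasurableSpace Ω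
  P : Measure Ω
  isProb : IsProbabilityMeasure P
  /-- the output at the input `f` for the random element `ω` -/
  out : Ω → F → G
  isDetAlg : ∀ ω, IsDetAlg Λ n (out ω)
  isMeasurable : IsMeasurableRandomized ev mΩ out

/-! ### Errors -/

/-- The worst case error of a deterministic algorithm `A` on the unit ball of `F`. -/
def detError {K : Type w} [RCLike K] {F G : Type*} [NormedAddCommGroup F] [InnerProductSpace K F]
    [NormedAddCommGroup G] [InnerProductSpace K G] (T : F →L[K] G) (A : F → G) : ℝ≥0∞ :=
  ⨆ (f : F) (_ : ‖f‖ ≤ 1), ‖T f - A f‖ₑ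

/-- The worst case (root mean square) error of a randomized algorithm on the unit ball of `F`. -/
def ranError {D : Type u} {K : Type w} [RCLike K] {F : Type v} {G : Type*}
    [NormedAddCommGroup F] [InnerProductSpace K F]
    [NormedAddCommGroup G] [InnerProductSpace K G] (T : F →L[K] G)
    {ev : F →ₗ[K] (D → K)} {Λ : Set (F →ₗ[K] K)} {n : ℕ} (A : RandomizedAlg G ev Λ n) : ℝ≥0∞ :=
  ⨆ (f : F) (_ : ‖f‖ ≤ 1),
    (@lintegral A.Ω A.mΩ A.P fun ω => ‖T f - A.out ω f‖ₑ ^ 2) ^ (1 / 2 : ℝ)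

/-- `e^det(n, T, Λ)`: the minimal worst case error of deterministic algorithms. -/
def minDetError {K : Type w} [RCLike K] {F G : Type*}
    [NormedAddCommGroup F] [InnerProductSpace K F]
    [NormedAddCommGroup G] [InnerProductSpace K G] (T : F →L[K] G)
    (Λ : Set (F →ₗ[K] K)) (n : ℕ) : ℝ≥0∞ :=
  ⨅ (A : F → G) (_ : IsDetAlg Λ n A), detError T A

/-- `e^ran(n, T, Λ)`: the minimal worst case error of measurable randomized algorithms. -/
def minRanError {D : Type u} {K : Type w} [RCLike K] {F : Type v} {G : Type*}
    [NormedAddCommGroup F] [InnerProductSpace K F]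
    [NormedAddCommGroup G] [InnerProductSpace K G] (T : F →L[K] G)
    (ev : F →ₗ[K] (D → K)) (Λ : Set (F →ₗ[K] K)) (n : ℕ) : ℝ≥0∞ :=
  ⨅ A : RandomizedAlg G ev Λ n, ranError T A

end

/-!
Let `s 0 ≥ s 1 ≥ …` be the singular values of `T` and `e 0, e 1, …` the corresponding orthonormal
eigenvectors of `T* T` (`SingularSystem`). If `F` has infinite dimension, all `s n` are positive,
and all three minimal errors turn out to be of the order of `s n`.

*Arbitrary functionals.* Orthogonal projection onto the first `n` eigenvectors is a linear algorithm
with error `s n`. Conversely, a deterministic algorithm cannot distinguish `f` from `-f` for some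
unit vector `f` in the span of `e 0, …, e n`, whence its error is at least `s n`
(`SingularSystem.le_minDetError`). For randomized algorithms the worst case error is bounded below
by the average over `f` in a spherical shell of the real span of `e 0, …, e (4 * n - 1)`, and by
Tonelli's theorem it suffices to bound the average error of deterministic algorithms, which evaluate
at most `2 * n` real functionals. For radial weights this is an induction over the number of
evaluations (`IsDetAlg.le_lintegral_radial`): rotate the first functional to a multiple of a
coordinate, and use that on each fibre of this coordinate the algorithm has one evaluation less and
the weight is again radial. Only the measurability of the output enters, not that of the
adaptive choices. The result is the lower bound `s (4 * n) / 3` (`SingularSystem.le_minRanError`).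

*Function values.* Let `b j` be the function `e j / s j`, normalized in `L²`, and draw one point `x`
from the density `ρ = (|b 0|² + ⋯ + |b (m - 1)|²) / m`. For `h` in `L²`, the function
`∑ j < m, conj (b j x) * h x / ρ x • b j` is an unbiased estimator of the orthogonal projection of
`h` onto the span of `b 0, …, b (m - 1)`, with second moment at most `m * ‖h‖²`. Applying this to
the residual `h = f - a` of a current approximation `a` in that span, and adding `1 / m` times the
estimate to `a`, turns a mean squared error `r` into at most `(1 - 1 / m) * r + 2 / m * s m ^ 2`
(`HasMonteCarlo.step`). Hence `ℓ * m` samples contract the squared error by `exp (-ℓ)` up to the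
term `2 * s m ^ 2` (`HasMonteCarlo.block`). Doubling `m` after each block and choosing `ℓ` so large
that `exp (-ℓ)` beats the factor lost in `s m ≤ C * s (2 * m)`, the error after `n` samples is of
the order of `s n`, and by the doubling condition of that of `s (4 * n)`.

If `F` has finite dimension, finitely many function values determine `f`, and all three errors
vanish eventually.
-/

open MeasureTheory
open scoped ENNReal NNReal

/-! ### Singular systems of compact operators -/

open ContinuousLinearMap in
/-- A compact operator `T` attains its norm on a nontrivial closed subspace `W` invariant under
`T* T`, at an eigenvector of `T* T`. -/
theorem exists_unit_eigenvector_norm_le {K : Type*} [RCLike K] {F G : Type*}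
    [NormedAddCommGroup F] [InnerProductSpace K F] [CompleteSpace F]
    [NormedAddCommGroup G] [InnerProductSpace K G] [CompleteSpace G]
    (T : F →L[K] G) (hinj : Function.Injective T) (hT : IsCompactOperator T)
    (W : Submodule K F) (hWc : IsClosed (W : Set F)) (hW : W ≠ ⊥)
    (hinv : ∀ f ∈ W, (adjoint T) (T f) ∈ W) :
    ∃ e ∈ W, ‖e‖ = 1 ∧ ∃ s : ℝ, 0 < s ∧ (adjoint T) (T e) = ((s ^ 2 : ℝ) : K) • e ∧
      ∀ f ∈ W, ‖T f‖ ≤ s * ‖f‖ := by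
  have : CompleteSpace W := hWc.completeSpace_coe
  have : Nontrivial W := Submodule.nontrivial_iff_ne_bot.mpr hW
  let S : W →L[K] W := ((adjoint T).comp T).restrict hinv
  have hScoe : ∀ f : W, ((S f : W) : F) = adjoint T (T f) := fun f => rfl
  have hSc : IsCompactOperator S :=
    IsCompactOperator.restrict' (f := (((adjoint T).comp T : F →L[K] F) : F →ₗ[K] F))
      (hT.clm_comp (adjoint T)) hinv
  have hquad : ∀ f : W, inner K (S f) f = ((‖T f‖ ^ 2 : ℝ) : K) := by
    intro f
    rw [Submodule.coe_inner, hScoe, adjoint_inner_left, inner_self_eq_norm_sq_to_K]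
    push_cast; rfl
  have hSs : (S : W →ₗ[K] W).IsSymmetric := by
    intro f g
    change inner K (S f) g = inner K f (S g)
    rw [Submodule.coe_inner, Submodule.coe_inner, hScoe, hScoe, adjoint_inner_left,
      adjoint_inner_right]
  have hS0 : S ≠ 0 := by
    intro h
    obtain ⟨f, hf⟩ := exists_ne (0 : W)
    have h1 := hquad f
    rw [h] at h1
    simp only [_root_.zero_apply, inner_zero_left] at h1
    have h2 : ‖T (f : F)‖ ^ 2 = 0 := by exact_mod_cast h1.symm
    have h3 : T (f : F) = 0 := by simpa using h2
    exact hf (Subtype.ext (hinj (by simpa using h3)))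
  have hSn : 0 < ‖S‖ := norm_pos_iff.mpr hS0
  -- the norm is the spectral radius, which is attained at a nonzero point of the spectrum
  have hne : (spectrum K S).Nonempty := by
    by_contra hcon
    rw [Set.not_nonempty_iff_eq_empty] at hcon
    have := S.spectralRadius_eq_nnnorm hSs.isSelfAdjoint
    rw [spectralRadius, hcon] at this
    simp at this
    exact hS0 (nnnorm_eq_zero.mp this.symm)
  obtain ⟨c, hc, hcn⟩ := spectrum.exists_nnnorm_eq_spectralRadius_of_nonempty hne
  rw [S.spectralRadius_eq_nnnorm hSs.isSelfAdjoint] at hcn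
  have hcn' : ‖c‖ = ‖S‖ := by
    have : ‖c‖₊ = ‖S‖₊ := by exact_mod_cast hcn
    exact congrArg NNReal.toReal this
  have hc0 : c ≠ 0 := by rw [← norm_pos_iff, hcn']; exact hSn
  have hev := (hSc.hasEigenvalue_iff_mem_spectrum hc0).mpr hc
  obtain ⟨x, hx⟩ := hev.exists_hasEigenvector
  have hx0 : x ≠ 0 := hx.2
  have hxS : S x = c • x := hx.apply_eq_smul
  have hxn : 0 < ‖x‖ := norm_pos_iff.mpr hx0
  -- the eigenvalue is real and positive
  have h1 := hquad x
  rw [hxS, inner_smul_left, inner_self_eq_norm_sq_to_K] at h1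
  have h2 : (starRingEnd K) c = ((‖T x‖ ^ 2 / ‖x‖ ^ 2 : ℝ) : K) := by
    have : ((‖x‖ : ℝ) : K) ^ 2 ≠ 0 := by
      exact_mod_cast (pow_pos hxn 2).ne'
    push_cast
    rw [eq_div_iff this, h1]
    push_cast; rfl
  have h3 : c = ((‖T x‖ ^ 2 / ‖x‖ ^ 2 : ℝ) : K) := by
    rw [← RCLike.conj_conj c, h2, RCLike.conj_ofReal]
  have h4 : c = ((‖S‖ : ℝ) : K) := by
    rw [← hcn', h3, RCLike.norm_ofReal, abs_of_nonneg (by positivity)]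
  refine ⟨((‖x‖⁻¹ : ℝ) : K) • (x : F), W.smul_mem _ x.2, ?_, Real.sqrt ‖S‖,
    Real.sqrt_pos.mpr hSn, ?_, ?_⟩
  · rw [norm_smul, RCLike.norm_ofReal, abs_of_pos (by positivity)]
    exact inv_mul_cancel₀ hxn.ne'
  · rw [map_smul, map_smul, ← hScoe, hxS, Real.sq_sqrt hSn.le, h4]
    simp only [Submodule.coe_smul]
    rw [smul_comm]
  · intro f hf
    have h5 := hquad ⟨f, hf⟩
    have h6 : ‖T f‖ ^ 2 ≤ ‖S‖ * ‖f‖ ^ 2 := by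
      have h7 : ‖inner K (S ⟨f, hf⟩) (⟨f, hf⟩ : W)‖ ≤ ‖S‖ * ‖f‖ * ‖f‖ :=
        (norm_inner_le_norm _ _).trans
          (mul_le_mul_of_nonneg_right (S.le_opNorm ⟨f, hf⟩) (norm_nonneg _))
      rw [h5, RCLike.norm_ofReal, abs_of_nonneg (by positivity)] at h7
      linarith
    refine abs_le_of_sq_le_sq' ?_ (by positivity) |>.2
    rw [mul_pow, Real.sq_sqrt hSn.le]
    exact h6

/-- The right half of a singular value decomposition of an operator `T` of infinite rank: the `e n`
are orthonormal eigenvectors of `T* T` with eigenvalues `s n ^ 2` in decreasing order, and `s n` bounds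
`T` on the orthogonal complement of `e 0, …, e (n - 1)`. -/
structure SingularSystem {K : Type*} [RCLike K] {F G : Type*}
    [NormedAddCommGroup F] [InnerProductSpace K F] [CompleteSpace F]
    [NormedAddCommGroup G] [InnerProductSpace K G] [CompleteSpace G]
    (T : F →L[K] G) (e : ℕ → F) (s : ℕ → ℝ) : Prop where
  orthonormal : Orthonormal K e
  pos : ∀ n, 0 < s n
  eigen : ∀ n, ContinuousLinearMap.adjoint T (T (e n)) = ((s n ^ 2 : ℝ) : K) • e n
  norm_le : ∀ n f, (∀ i < n, inner K (e i) f = 0) → ‖T f‖ ≤ s n * ‖f‖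

/-- The sequence in which each term is chosen by `Φ` from the orthogonal complement of the
preceding ones. -/
noncomputable def orthogonalSeq {K : Type*} [RCLike K] {F : Type*}
    [NormedAddCommGroup F] [InnerProductSpace K F] (Φ : Submodule K F → F) : ℕ → F
  | n => Φ (Submodule.span K (Set.range fun i : Fin n => orthogonalSeq Φ i))ᗮ
  decreasing_by exact i.2

/-- The singular vectors are found one after the other, each one maximizing `‖T f‖` over the unit
vectors `f` orthogonal to the preceding ones. -/
theorem exists_singularSystem {K : Type*} [RCLike K] {F G : Type*}
    [NormedAddCommGroup F] [InnerProductSpace K F] [CompleteSpace F]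
    [NormedAddCommGroup G] [InnerProductSpace K G] [CompleteSpace G]
    (T : F →L[K] G) (hinj : Function.Injective T) (hT : IsCompactOperator T)
    (hF : ¬ FiniteDimensional K F) : ∃ e s, SingularSystem T e s := by
  classical
  let Good : Submodule K F → F → Prop := fun W e => e ∈ W ∧ ‖e‖ = 1 ∧
    ∃ s : ℝ, 0 < s ∧ (ContinuousLinearMap.adjoint T) (T e) = ((s ^ 2 : ℝ) : K) • e ∧
      ∀ f ∈ W, ‖T f‖ ≤ s * ‖f‖
  let Φ : Submodule K F → F := fun W => if h : ∃ e, Good W e then h.choose else 0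
  have hΦ : ∀ W, (∃ e, Good W e) → Good W (Φ W) := by
    intro W h
    simp only [Φ, dif_pos h]
    exact h.choose_spec
  let e := orthogonalSeq Φ
  let V : ℕ → Submodule K F := fun n => Submodule.span K (Set.range fun i : Fin n => e i)
  have heq : ∀ n, e n = Φ (V n)ᗮ := fun n => by
    simp only [e, V]; rw [orthogonalSeq]
  have hmem : ∀ n f, f ∈ (V n)ᗮ ↔ ∀ i < n, inner K (e i) f = 0 := by
    intro n f
    rw [Submodule.mem_orthogonal]
    constructor
    · intro h i hi
      exact h _ (Submodule.subset_span ⟨⟨i, hi⟩, rfl⟩)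
    · intro h g hg
      induction hg using Submodule.span_induction with
      | mem x hx => obtain ⟨i, rfl⟩ := hx; exact h i i.2
      | zero => simp
      | add x y _ _ hx hy => rw [inner_add_left, hx, hy, add_zero]
      | smul a x _ hx => rw [inner_smul_left, hx, mul_zero]
  have hgood : ∀ n, Good (V n)ᗮ (e n) := by
    intro n
    induction n using Nat.strong_induction_on with
    | _ n ih =>
      rw [heq]
      apply hΦ
      have hne : (V n)ᗮ ≠ ⊥ := by
        intro h
        have hfin : FiniteDimensional K (V n) :=
          FiniteDimensional.span_of_finite K (Set.finite_range _)
        rw [Submodule.orthogonal_eq_bot_iff] at h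
        exact hF (Module.finite_def.mpr (h ▸ (Module.Finite.iff_fg.mp hfin)))
      have hinv : ∀ f ∈ (V n)ᗮ, (ContinuousLinearMap.adjoint T) (T f) ∈ (V n)ᗮ := by
        intro f hf
        rw [hmem] at hf ⊢
        intro i hi
        obtain ⟨_, _, s, _, hs, _⟩ := ih i hi
        rw [ContinuousLinearMap.adjoint_inner_right, ← ContinuousLinearMap.adjoint_inner_left, hs,
          inner_smul_left, hf i hi, mul_zero]
      exact exists_unit_eigenvector_norm_le T hinj hT (V n)ᗮ (Submodule.isClosed_orthogonal _)
        hne hinv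
  choose hV hn s hs0 hs hle using hgood
  refine ⟨e, s, ⟨⟨hn, ?_⟩, hs0, hs, fun n f hf => hle n f ((hmem n f).mpr hf)⟩⟩
  intro i j hij
  rcases lt_or_gt_of_ne hij with h | h
  · exact (hmem j _).mp (hV j) i h
  · rw [inner_eq_zero_symm]; exact (hmem i _).mp (hV i) j h

theorem exists_ne_zero_forall_linear_eq_zero {K : Type*} [Field K] {n : ℕ}
    (L : Fin n → (Fin (n + 1) → K) →ₗ[K] K) : ∃ c : Fin (n + 1) → K, c ≠ 0 ∧ ∀ i, L i c = 0 := by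
  have h := LinearMap.ker_ne_bot_of_finrank_lt (f := LinearMap.pi L) (by simp)
  obtain ⟨c, hc, h0⟩ := (Submodule.ne_bot_iff _).mp h
  exact ⟨c, h0, fun i => congrFun (LinearMap.mem_ker.mp hc) i⟩

theorem Orthonormal.norm_sum_smul_sq {K : Type*} [RCLike K] {F : Type*}
    [NormedAddCommGroup F] [InnerProductSpace K F] {ι : Type*} [Fintype ι] {g : ι → F}
    (hg : Orthonormal K g) (c : ι → K) : ‖∑ i, c i • g i‖ ^ 2 = ∑ i, ‖c i‖ ^ 2 := by
  have h : ((‖∑ i, c i • g i‖ ^ 2 : ℝ) : K) = ((∑ i, ‖c i‖ ^ 2 : ℝ) : K) := by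
    push_cast
    rw [← inner_self_eq_norm_sq_to_K, hg.inner_sum]
    exact Finset.sum_congr rfl fun i _ => RCLike.conj_mul _
  exact_mod_cast h

/-- On the span of orthonormal eigenvectors of `T* T` with eigenvalues at least `t`, the operator
`T` expands squared norms by at least `t`. -/
theorem mul_sum_norm_sq_le_norm_map_sum {K : Type*} [RCLike K] {F G : Type*}
    [NormedAddCommGroup F] [InnerProductSpace K F] [CompleteSpace F]
    [NormedAddCommGroup G] [InnerProductSpace K G] [CompleteSpace G] {T : F →L[K] G}
    {n : ℕ} {g : Fin n → F} (hg : Orthonormal K g)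
    {t : ℝ} {r : Fin n → ℝ} (ht : ∀ i, t ≤ r i)
    (hr : ∀ i, ContinuousLinearMap.adjoint T (T (g i)) = ((r i : ℝ) : K) • g i) (c : Fin n → K) :
    t * ∑ i, ‖c i‖ ^ 2 ≤ ‖T (∑ i, c i • g i)‖ ^ 2 := by
  have h1 : ((‖T (∑ i, c i • g i)‖ ^ 2 : ℝ) : K) = ((∑ i, r i * ‖c i‖ ^ 2 : ℝ) : K) := by
    have : ((‖T (∑ i, c i • g i)‖ ^ 2 : ℝ) : K)
        = inner K (ContinuousLinearMap.adjoint T (T (∑ i, c i • g i))) (∑ i, c i • g i) := by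
      rw [ContinuousLinearMap.adjoint_inner_left, inner_self_eq_norm_sq_to_K]; push_cast; rfl
    rw [this]
    simp only [map_sum, map_smul, hr]
    rw [show ∑ i, c i • ((r i : ℝ) : K) • g i = ∑ i, (c i * ((r i : ℝ) : K)) • g i from
      Finset.sum_congr rfl fun i _ => smul_smul _ _ _, hg.inner_sum]
    push_cast
    refine Finset.sum_congr rfl fun i _ => ?_
    rw [map_mul, RCLike.conj_ofReal, mul_comm _ ((r i : ℝ) : K), mul_assoc, RCLike.conj_mul]
  have h2 : ‖T (∑ i, c i • g i)‖ ^ 2 = ∑ i, r i * ‖c i‖ ^ 2 := by exact_mod_cast h1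
  rw [h2, Finset.mul_sum]
  exact Finset.sum_le_sum fun i _ => mul_le_mul_of_nonneg_right (ht i) (by positivity)

namespace SingularSystem

variable {K : Type*} [RCLike K] {F G : Type*}
    [NormedAddCommGroup F] [InnerProductSpace K F] [CompleteSpace F]
    [NormedAddCommGroup G] [InnerProductSpace K G] [CompleteSpace G]
    {T : F →L[K] G} {e : ℕ → F} {s : ℕ → ℝ}

theorem inner_map_map (h : SingularSystem T e s) (n : ℕ) (f : F) :
    inner K (T (e n)) (T f) = ((s n ^ 2 : ℝ) : K) * inner K (e n) f := by
  rw [← ContinuousLinearMap.adjoint_inner_left, h.eigen, inner_smul_left, RCLike.conj_ofReal]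

theorem norm_map (h : SingularSystem T e s) (n : ℕ) : ‖T (e n)‖ = s n := by
  have h1 := h.inner_map_map n (e n)
  rw [inner_self_eq_norm_sq_to_K, inner_self_eq_norm_sq_to_K, h.orthonormal.1 n] at h1
  have h2 : ‖T (e n)‖ ^ 2 = s n ^ 2 := by
    have : (((‖T (e n)‖ ^ 2 : ℝ)) : K) = ((s n ^ 2 : ℝ) : K) := by
      push_cast at h1 ⊢; rw [h1]; simp
    exact_mod_cast this
  exact (sq_eq_sq₀ (norm_nonneg _) (h.pos n).le).mp h2

theorem antitone (h : SingularSystem T e s) : Antitone s := by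
  apply antitone_nat_of_succ_le
  intro n
  have := h.norm_le n (e (n + 1)) fun i hi => h.orthonormal.2 (by omega)
  rwa [h.norm_map, h.orthonormal.1, mul_one] at this

/-- The left singular vectors `T (e n) / s n` are orthonormal. -/
theorem orthonormal_left (h : SingularSystem T e s) :
    Orthonormal K fun n => (((s n)⁻¹ : ℝ) : K) • T (e n) := by
  constructor
  · intro n
    rw [norm_smul, h.norm_map, RCLike.norm_ofReal, abs_of_pos (inv_pos.mpr (h.pos n)),
      inv_mul_cancel₀ (h.pos n).ne']
  · intro i j hij
    change inner K ((((s i)⁻¹ : ℝ) : K) • T (e i)) ((((s j)⁻¹ : ℝ) : K) • T (e j)) = 0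
    rw [inner_smul_left, inner_smul_right, h.inner_map_map, h.orthonormal.2 hij]
    simp

/-- The singular values in the sense of eigenvalue counting are the `s n`. -/
theorem nthSingularValue_succ (h : SingularSystem T e s) (n : ℕ) :
    nthSingularValue T (n + 1) = s n := by
  have hmax : IsGreatest {t : ℝ | 0 ≤ t ∧ ∃ e : Fin (n + 1) → F, Orthonormal K e ∧
      ∀ i, ∃ s : ℝ, t ≤ s ∧
        ((ContinuousLinearMap.adjoint T).comp T) (e i) = (s : K) • e i} (s n ^ 2) := by
    constructor
    · refine ⟨sq_nonneg _, fun i => e i, h.orthonormal.comp _ Fin.val_injective, fun i =>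
        ⟨s i ^ 2, ?_, h.eigen i⟩⟩
      exact pow_le_pow_left₀ (h.pos n).le (h.antitone (by omega)) 2
    · rintro t ⟨ht, g, hg, hr⟩
      choose r htr hr using hr
      -- a combination of the `g i` orthogonal to `e 0, …, e (n - 1)`
      obtain ⟨c, hc0, hc⟩ := exists_ne_zero_forall_linear_eq_zero (K := K) (n := n)
        fun i => (innerₛₗ K (e i)).comp (Fintype.linearCombination K g)
      have h1 := h.norm_le n (∑ i, c i • g i) fun i hi => by
        simpa [Fintype.linearCombination_apply] using hc ⟨i, hi⟩
      have h2 := mul_sum_norm_sq_le_norm_map_sum (T := T) hg htr hr c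
      have h3 : ‖∑ i, c i • g i‖ ^ 2 = ∑ i, ‖c i‖ ^ 2 := by
        exact hg.norm_sum_smul_sq c
      have h4 : 0 < ∑ i, ‖c i‖ ^ 2 := by
        obtain ⟨i, hi⟩ := Function.ne_iff.mp hc0
        exact Finset.sum_pos' (fun i _ => by positivity)
          ⟨i, Finset.mem_univ _, by have := norm_pos_iff.mpr hi; positivity⟩
      have h5 : ‖T (∑ i, c i • g i)‖ ^ 2 ≤ s n ^ 2 * ∑ i, ‖c i‖ ^ 2 := by
        rw [← h3, ← mul_pow]
        exact pow_le_pow_left₀ (norm_nonneg _) h1 2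
      exact le_of_mul_le_mul_right (h2.trans h5) h4
  rw [nthSingularValue, nthEigenvalue, hmax.csSup_eq, Real.sqrt_sq (h.pos n).le]

end SingularSystem

/-- The domain of an injective compact operator between Hilbert spaces is separable. -/
theorem secondCountableTopology_of_injective_of_isCompactOperator {K : Type*} [RCLike K]
    {F G : Type*} [NormedAddCommGroup F] [InnerProductSpace K F] [CompleteSpace F]
    [NormedAddCommGroup G] [InnerProductSpace K G] [CompleteSpace G]
    (T : F →L[K] G) (hinj : Function.Injective T) (hT : IsCompactOperator T) :
    SecondCountableTopology F := by
  obtain ⟨S, hSdef⟩ : ∃ S : F →L[K] F, S = (ContinuousLinearMap.adjoint T).comp T := ⟨_, rfl⟩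
  have hS : IsCompactOperator S := hSdef ▸ hT.clm_comp (ContinuousLinearMap.adjoint T)
  have hSapp : ∀ f, S f = ContinuousLinearMap.adjoint T (T f) := fun f => by
    rw [hSdef, ContinuousLinearMap.comp_apply]
  -- `T* T` is self-adjoint and injective, so its range is dense
  have hdense : (LinearMap.range (S : F →ₗ[K] F)).topologicalClosure = ⊤ := by
    rw [Submodule.topologicalClosure_eq_top_iff, Submodule.eq_bot_iff]
    intro f hf
    have h1 := (Submodule.mem_orthogonal _ _).mp hf (S f) ⟨f, rfl⟩
    have h2 : inner K (S f) f = inner K (T f) (T f) := by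
      rw [hSapp, ContinuousLinearMap.adjoint_inner_left]
    rw [h2, inner_self_eq_zero] at h1
    exact hinj (by simpa using h1)
  -- the range is a countable union of images of balls, which are relatively compact
  have hsep : TopologicalSpace.IsSeparable (Set.range S) := by
    have : Set.range S = ⋃ n : ℕ, S '' Metric.closedBall 0 n := by
      rw [← Set.image_iUnion, Metric.iUnion_closedBall_nat, Set.image_univ]
    rw [this]
    refine TopologicalSpace.IsSeparable.iUnion fun n => ?_
    exact (hS.isCompact_closure_image_closedBall (f := (S : F →ₗ[K] F)) n).isSeparable.mono
      subset_closure
  have hsep' := hsep.closure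
  have huniv : closure (Set.range S) = Set.univ := by
    have := congrArg (fun V : Submodule K F => (V : Set F)) hdense
    rwa [Submodule.topologicalClosure_coe, LinearMap.coe_range, Submodule.top_coe] at this
  rw [huniv] at hsep'
  have : TopologicalSpace.SeparableSpace F := TopologicalSpace.isSeparable_univ_iff.mp hsep'
  exact UniformSpace.secondCountable_of_separable F

/-! ### Deterministic algorithms -/

namespace IsDetAlg

variable {K : Type*} [RCLike K] {F G G' : Type*} [AddCommGroup F] [Module K F]
  {Λ Λ' : Set (F →ₗ[K] K)} {n m : ℕ} {A : F → G}

theorem mono (h : IsDetAlg Λ n A) (hΛ : Λ ⊆ Λ') (hnm : n ≤ m) : IsDetAlg Λ' m A := by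
  induction h generalizing m with
  | const n g => exact const m g
  | query n L hL B _ ih =>
    obtain ⟨m, rfl⟩ : ∃ k, m = k + 1 := ⟨m - 1, by omega⟩
    exact query m L (hΛ hL) B fun y => ih y (by omega)

theorem map (h : IsDetAlg Λ n A) (φ : G → G') : IsDetAlg Λ n fun f => φ (A f) := by
  induction h with
  | const n g => exact const n (φ g)
  | query n L hL B _ ih => exact query n L hL (fun y f => φ (B y f)) ih

/-- An algorithm may make one further evaluation and combine its value with the output. -/
theorem append (h : IsDetAlg Λ n A) {L : F →ₗ[K] K} (hL : L ∈ Λ) (g : G → K → G') :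
    IsDetAlg Λ (n + 1) fun f => g (A f) (L f) := by
  induction h with
  | const n a => exact query n L hL (fun y _ => g a y) fun y => const n (g a y)
  | query n L' hL' B _ ih => exact query (n + 1) L' hL' (fun y f => g (B y f) (L f)) ih

/-- Nonadaptive algorithms are algorithms. -/
theorem of_values {n : ℕ} (L : Fin n → F →ₗ[K] K) (hL : ∀ i, L i ∈ Λ) (φ : (Fin n → K) → G) :
    IsDetAlg Λ n fun f => φ fun i => L i f := by
  induction n with
  | zero =>
    have : (fun f => φ fun i => L i f) = fun _ => φ 0 := by
      ext f; exact congrArg φ (Subsingleton.elim _ _)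
    rw [this]; exact const 0 _
  | succ n ih =>
    have h := query n (L 0) (hL 0) (fun y f => φ (Fin.cons y fun i => L i.succ f))
      fun y => ih (fun i => L i.succ) (fun i => hL i.succ) fun z => φ (Fin.cons y z)
    convert h using 3 with f
    exact (Fin.cons_self_tail (fun i => L i f)).symm

/-- An algorithm is constant on the kernel of the functionals that it evaluates at zero. -/
theorem exists_forall_eq_map_zero (h : IsDetAlg Λ n A) :
    ∃ L : Fin n → F →ₗ[K] K, ∀ f, (∀ i, L i f = 0) → A f = A 0 := by
  induction h with
  | const n g => exact ⟨fun _ => 0, fun _ _ => rfl⟩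
  | query n L hL B _ ih =>
    obtain ⟨L', h'⟩ := ih 0
    refine ⟨Fin.cons L L', fun f hf => ?_⟩
    have h0 : L f = 0 := hf 0
    simp only [h0, map_zero]
    exact h' f fun i => by simpa using hf i.succ

/-- One evaluation of a `K`-valued functional amounts to at most two evaluations of real
functionals. -/
theorem restrict_real (h : IsDetAlg Λ n A) {E : Type*} [AddCommGroup E] [Module ℝ E]
    (ι : E →+ F) (hι : ∀ (r : ℝ) x, ι (r • x) = (r : K) • ι x) :
    IsDetAlg (Set.univ : Set (E →ₗ[ℝ] ℝ)) (2 * n) fun x => A (ι x) := by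
  induction h with
  | const n g => exact const _ g
  | query n L hL B _ ih =>
    let Lre : E →ₗ[ℝ] ℝ :=
      { toFun := fun x => RCLike.re (L (ι x))
        map_add' := fun x y => by simp
        map_smul' := fun r x => by simp [hι] }
    let Lim : E →ₗ[ℝ] ℝ :=
      { toFun := fun x => RCLike.im (L (ι x))
        map_add' := fun x y => by simp
        map_smul' := fun r x => by simp [hι] }
    have h1 := query (2 * n + 1) Lre (Set.mem_univ _)
      (fun y x => B ((y : K) + (Lim x : K) * RCLike.I) (ι x))
      fun y => query (2 * n) Lim (Set.mem_univ _)
        (fun z x => B ((y : K) + (z : K) * RCLike.I) (ι x)) fun z => ih _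
    have h2 : (fun x => B (L (ι x)) (ι x)) =
        fun x => B ((Lre x : K) + (Lim x : K) * RCLike.I) (ι x) := by
      ext x
      change _ = B (((RCLike.re (L (ι x)) : ℝ) : K) + ((RCLike.im (L (ι x)) : ℝ) : K) * RCLike.I)
        (ι x)
      rw [RCLike.re_add_im]
    rw [h2]
    exact h1

theorem comp_affine {Λ : Set (F →ₗ[K] K)} (h : IsDetAlg Λ n A) {E : Type*} [AddCommGroup E]
    [Module K E] (ι : E →ₗ[K] F) (p : F) :
    IsDetAlg (Set.univ : Set (E →ₗ[K] K)) n fun x => A (p + ι x) := by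
  induction h with
  | const n g => exact const _ g
  | query n L hL B _ ih =>
    have h1 := query n (L.comp ι) (Set.mem_univ _) (fun y x => B (L p + y) (p + ι x))
      fun y => ih _
    simpa using h1

end IsDetAlg

/-! ### Average case errors for radial weights on `ℝ^d` -/

/-- The integral over `ℝ^(d+1)` as an iterated integral over the first and the other coordinates. -/
theorem lintegral_fin_succ {d : ℕ} {g : (Fin (d + 1) → ℝ) → ℝ≥0∞} (hg : Measurable g) :
    ∫⁻ x, g x = ∫⁻ y : ℝ, ∫⁻ z : Fin d → ℝ, g (Fin.cons y z) := by
  have h := (volume_preserving_piFinSuccAbove (fun _ : Fin (d + 1) => ℝ) 0).symm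
  rw [← h.lintegral_comp hg, Measure.volume_eq_prod, lintegral_prod
    (f := fun p => g ((MeasurableEquiv.piFinSuccAbove (fun _ : Fin (d + 1) => ℝ) 0).symm p))
    (hg.comp (MeasurableEquiv.measurable _)).aemeasurable]
  simp [MeasurableEquiv.piFinSuccAbove, Fin.insertNthEquiv]

theorem lintegral_radial_mul_sq_eq {d : ℕ} {w : ℝ → ℝ≥0∞} (hw : Measurable w) (i j : Fin d) :
    ∫⁻ x : Fin d → ℝ, w (∑ k, x k ^ 2) * ENNReal.ofReal (x i ^ 2) =
      ∫⁻ x : Fin d → ℝ, w (∑ k, x k ^ 2) * ENNReal.ofReal (x j ^ 2) := by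
  have h := volume_measurePreserving_piCongrLeft (fun _ : Fin d => ℝ) (Equiv.swap i j)
  have happ : ∀ (x : Fin d → ℝ) k,
      MeasurableEquiv.piCongrLeft (fun _ : Fin d => ℝ) (Equiv.swap i j) x k
        = x (Equiv.swap i j k) := by
    intro x k
    have := MeasurableEquiv.piCongrLeft_apply_apply (Equiv.swap i j) (β := fun _ : Fin d => ℝ) x
      (Equiv.swap i j k)
    rwa [Equiv.swap_apply_self] at this
  rw [← h.lintegral_comp (by fun_prop)]
  refine lintegral_congr fun x => ?_
  simp only [happ, Equiv.swap_apply_left]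
  rw [Equiv.sum_comp (Equiv.swap i j) fun k => x k ^ 2]

theorem lintegral_radial_mul_sum_sq {d : ℕ} {w : ℝ → ℝ≥0∞} (hw : Measurable w) (i : Fin d) :
    (d : ℝ≥0∞) * ∫⁻ x : Fin d → ℝ, w (∑ k, x k ^ 2) * ENNReal.ofReal (x i ^ 2) =
      ∫⁻ x : Fin d → ℝ, w (∑ k, x k ^ 2) * ENNReal.ofReal (∑ k, x k ^ 2) := by
  simp_rw [ENNReal.ofReal_sum_of_nonneg fun k _ => sq_nonneg _, Finset.mul_sum]
  rw [lintegral_finsetSum _ fun k _ => by fun_prop,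
    Finset.sum_congr rfl fun k _ => lintegral_radial_mul_sq_eq hw k i]
  simp

/-- After a rotation of the space, a linear functional depends on the first coordinate only. -/
theorem exists_rotation {d : ℕ} (L : (Fin (d + 1) → ℝ) →ₗ[ℝ] ℝ) :
    ∃ U : (Fin (d + 1) → ℝ) ≃ₗ[ℝ] (Fin (d + 1) → ℝ), MeasurePreserving U volume volume ∧
      (∀ x, ∑ i, (U x i) ^ 2 = ∑ i, x i ^ 2) ∧ ∃ c : ℝ, ∀ x, L (U x) = c * x 0 := by
  let v : EuclideanSpace ℝ (Fin (d + 1)) := WithLp.toLp 2 fun i => L (Pi.single i 1)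
  have hL : ∀ x : EuclideanSpace ℝ (Fin (d + 1)), L (WithLp.ofLp x) = inner ℝ v x := by
    intro x
    conv_lhs => rw [pi_eq_sum_univ' (WithLp.ofLp x)]
    simp [PiLp.inner_apply, v]
  obtain ⟨b, c, hb⟩ : ∃ b : OrthonormalBasis (Fin (d + 1)) ℝ (EuclideanSpace ℝ (Fin (d + 1))),
      ∃ c : ℝ, v = c • b 0 := by
    by_cases hv : v = 0
    · exact ⟨EuclideanSpace.basisFun _ ℝ, 0, by simp [hv]⟩
    · have hv' : ‖v‖ ≠ 0 := norm_ne_zero_iff.mpr hv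
      obtain ⟨b, hb⟩ := Orthonormal.exists_orthonormalBasis_extension_of_card_eq (𝕜 := ℝ)
        (E := EuclideanSpace ℝ (Fin (d + 1))) (ι := Fin (d + 1)) (by simp)
        (v := fun _ => ‖v‖⁻¹ • v) (s := {0}) (by
          constructor
          · intro i
            simp [norm_smul, inv_mul_cancel₀ hv']
          · intro i j hij
            exact absurd (Subsingleton.elim i j) hij)
      refine ⟨b, ‖v‖, ?_⟩
      rw [hb 0 rfl, smul_smul, mul_inv_cancel₀ hv', one_smul]
  refine ⟨(WithLp.linearEquiv 2 ℝ (Fin (d + 1) → ℝ)).symm.trans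
    (b.repr.symm.toLinearEquiv.trans (WithLp.linearEquiv 2 ℝ (Fin (d + 1) → ℝ))), ?_, ?_, c, ?_⟩
  · exact (PiLp.volume_preserving_ofLp (Fin (d + 1))).comp
      (b.measurePreserving_repr_symm.comp (PiLp.volume_preserving_toLp (Fin (d + 1))))
  · intro x
    have h1 := b.repr.symm.norm_map (WithLp.toLp 2 x)
    have h2 : ‖b.repr.symm (WithLp.toLp 2 x)‖ ^ 2 = ‖WithLp.toLp 2 x‖ ^ 2 := by rw [h1]
    rw [EuclideanSpace.norm_sq_eq, EuclideanSpace.norm_sq_eq] at h2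
    simp only [Real.norm_eq_abs, sq_abs] at h2
    exact h2
  · intro x
    change L (WithLp.ofLp (b.repr.symm (WithLp.toLp 2 x))) = _
    rw [hL, hb, real_inner_smul_left, ← b.repr_apply_apply]
    simp

/-- The average error of an adaptive algorithm that evaluates `n` linear functionals on `ℝ^d` is,
for any radial weight, at least that of the optimal nonadaptive algorithm, which is `d - n` times
the second moment of one coordinate. A functional may be assumed to be the first coordinate, and
the algorithm then runs on each fibre with one functional less, again with a radial weight. -/
theorem IsDetAlg.le_lintegral_radial (n : ℕ) : ∀ {d : ℕ} {w : ℝ → ℝ≥0∞} (_ : Measurable w)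
    {A : (Fin d → ℝ) → (Fin d → ℝ)} (_ : Measurable A) {Λ : Set ((Fin d → ℝ) →ₗ[ℝ] ℝ)}
    (_ : IsDetAlg Λ n A) (i : Fin d),
    ((d - n : ℕ) : ℝ≥0∞) * ∫⁻ x : Fin d → ℝ, w (∑ k, x k ^ 2) * ENNReal.ofReal (x i ^ 2) ≤
      ∫⁻ x : Fin d → ℝ, w (∑ k, x k ^ 2) * ENNReal.ofReal (∑ k, (x k - A x k) ^ 2) := by
  -- a constant output is no better than the centre
  have hconst : ∀ (n d : ℕ) (w : ℝ → ℝ≥0∞) (_ : Measurable w) (g : Fin d → ℝ) (i : Fin d),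
      ((d - n : ℕ) : ℝ≥0∞) * ∫⁻ x : Fin d → ℝ, w (∑ k, x k ^ 2) * ENNReal.ofReal (x i ^ 2) ≤
      ∫⁻ x : Fin d → ℝ, w (∑ k, x k ^ 2) * ENNReal.ofReal (∑ k, (x k - g k) ^ 2) := by
    intro n d w hw g i
    have h1 := lintegral_radial_mul_sum_sq hw i
    have h2 : ∫⁻ x : Fin d → ℝ, w (∑ k, x k ^ 2) * ENNReal.ofReal (∑ k, (x k - g k) ^ 2) =
        ∫⁻ x : Fin d → ℝ, w (∑ k, x k ^ 2) * ENNReal.ofReal (∑ k, (x k + g k) ^ 2) := by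
      rw [← (Measure.measurePreserving_neg (volume : Measure (Fin d → ℝ))).lintegral_comp
        (by fun_prop)]
      refine lintegral_congr fun x => ?_
      simp only [Pi.neg_apply, neg_sq]
      congr 2
      exact Finset.sum_congr rfl fun k _ => by ring
    have h3 : 2 * ∫⁻ x : Fin d → ℝ, w (∑ k, x k ^ 2) * ENNReal.ofReal (∑ k, x k ^ 2) ≤
        2 * ∫⁻ x : Fin d → ℝ, w (∑ k, x k ^ 2) * ENNReal.ofReal (∑ k, (x k - g k) ^ 2) := by
      conv_rhs => rw [two_mul]; arg 2; rw [h2]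
      rw [← lintegral_add_left (by fun_prop), ← lintegral_const_mul _ (by fun_prop)]
      refine lintegral_mono fun x => ?_
      change 2 * (w (∑ k, x k ^ 2) * ENNReal.ofReal (∑ k, x k ^ 2)) ≤
        w (∑ k, x k ^ 2) * ENNReal.ofReal (∑ k, (x k - g k) ^ 2) +
          w (∑ k, x k ^ 2) * ENNReal.ofReal (∑ k, (x k + g k) ^ 2)
      rw [← mul_add, ← ENNReal.ofReal_add (Finset.sum_nonneg fun k _ => sq_nonneg _)
        (Finset.sum_nonneg fun k _ => sq_nonneg _), mul_left_comm]
      gcongr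
      rw [← ENNReal.ofReal_ofNat 2, ← ENNReal.ofReal_mul (by norm_num), ← Finset.sum_add_distrib,
        Finset.mul_sum]
      refine ENNReal.ofReal_le_ofReal (Finset.sum_le_sum fun k _ => ?_)
      nlinarith [sq_nonneg (g k)]
    have h4 := (ENNReal.mul_le_mul_iff_right two_ne_zero ENNReal.ofNat_ne_top).mp h3
    refine le_trans ?_ (h1.trans_le h4)
    gcongr
    omega
  induction n with
  | zero =>
    intro d w hw A hA Λ hd i
    cases hd with
    | const _ g => exact hconst 0 d w hw g i
  | succ n ih =>
    intro d w hw A hA Λ hd i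
    cases hd with
    | const _ g => exact hconst (n + 1) d w hw g i
    | query _ L hL B hB =>
      obtain _ | d := d
      · exact i.elim0
      obtain _ | d := d
      · simp
      obtain ⟨U, hU, hUsq, c, hc⟩ := exists_rotation L
      obtain ⟨A, hAdef⟩ : ∃ A : (Fin (d + 2) → ℝ) → (Fin (d + 2) → ℝ), A = fun f => B (L f) f :=
        ⟨_, rfl⟩
      rw [← hAdef] at hA
      have hmeas : ∀ A : (Fin (d + 2) → ℝ) → (Fin (d + 2) → ℝ), Measurable A →
          Measurable fun x => w (∑ k, x k ^ 2) * ENNReal.ofReal (∑ k, (x k - A x k) ^ 2) := by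
        intro A hA
        have hAk : ∀ k, Measurable fun x => A x k := measurable_pi_iff.mp hA
        fun_prop
      have hUsymm : Measurable U.symm :=
        (LinearMap.continuous_of_finiteDimensional U.symm.toLinearMap).measurable
      let A' : (Fin (d + 2) → ℝ) → (Fin (d + 2) → ℝ) := fun x => U.symm (A (U x))
      have hA' : Measurable A' := hUsymm.comp (hA.comp hU.measurable)
      have hrot : ∫⁻ x : Fin (d + 2) → ℝ, w (∑ k, x k ^ 2) *
            ENNReal.ofReal (∑ k, (x k - A x k) ^ 2) =
          ∫⁻ x : Fin (d + 2) → ℝ, w (∑ k, x k ^ 2) *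
            ENNReal.ofReal (∑ k, (x k - A' x k) ^ 2) := by
        rw [← hU.lintegral_comp (hmeas A hA)]
        refine lintegral_congr fun x => ?_
        rw [hUsq]
        congr 2
        have h1 := hUsq (x - A' x)
        simp only [A', map_sub, LinearEquiv.apply_symm_apply] at h1
        exact h1
      change _ ≤ ∫⁻ x : Fin (d + 2) → ℝ, w (∑ k, x k ^ 2) *
        ENNReal.ofReal (∑ k, (x k - (fun f => B (L f) f) x k) ^ 2)
      rw [← hAdef, hrot, lintegral_fin_succ (hmeas A' hA'),
        lintegral_radial_mul_sq_eq hw i (Fin.succ 0), lintegral_fin_succ (by fun_prop),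
        ← lintegral_const_mul _ (by
          apply Measurable.lintegral_prod_right'
            (f := fun p : ℝ × (Fin (d + 1) → ℝ) =>
              w (∑ k, (Fin.cons p.1 p.2 : Fin (d + 2) → ℝ) k ^ 2)
              * ENNReal.ofReal ((Fin.cons p.1 p.2 : Fin (d + 2) → ℝ) (Fin.succ 0) ^ 2))
          simp only [Fin.sum_univ_succ (n := d + 1), Fin.cons_zero, Fin.cons_succ]
          fun_prop)]
      refine lintegral_mono fun y => ?_
      have hcons : Measurable fun z : Fin (d + 1) → ℝ => (Fin.cons y z : Fin (d + 2) → ℝ) := by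
        refine measurable_pi_iff.mpr fun k => ?_
        refine Fin.cases ?_ (fun k => ?_) k
        · simp
        · simpa using measurable_pi_apply k
      -- on the fibre, the first functional is constant
      have hfib : IsDetAlg (Set.univ : Set ((Fin (d + 1) → ℝ) →ₗ[ℝ] ℝ)) n
          fun z k => A' (Fin.cons y z) (Fin.succ k) := by
        let ι : (Fin (d + 1) → ℝ) →ₗ[ℝ] (Fin (d + 2) → ℝ) :=
          { toFun := fun z => Fin.cons 0 z
            map_add' := fun z z' => by ext k; refine Fin.cases ?_ (fun k => ?_) k <;> simp
            map_smul' := fun r z => by ext k; refine Fin.cases ?_ (fun k => ?_) k <;> simp }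
        have h1 := ((hB (c * y)).comp_affine (U.toLinearMap.comp ι) (U (Fin.cons y 0))).map
          fun (a : Fin (d + 2) → ℝ) (k : Fin (d + 1)) => U.symm a k.succ
        convert h1 using 3 with z k
        have h2 : U (Fin.cons y 0) + (U.toLinearMap.comp ι) z = U (Fin.cons y z) := by
          change U (Fin.cons y 0) + U (Fin.cons 0 z) = _
          rw [← map_add]
          congr 1
          ext k; refine Fin.cases ?_ (fun k => ?_) k <;> simp
        rw [h2]
        simp only [A', hAdef, hc, Fin.cons_zero]
      have h1 := ih (w := fun t => w (y ^ 2 + t)) (by fun_prop)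
        (A := fun z k => A' (Fin.cons y z) (Fin.succ k))
        (measurable_pi_iff.mpr fun k => (measurable_pi_apply _).comp (hA'.comp hcons)) hfib 0
      have hdn : d + 1 - n = d + 1 + 1 - (n + 1) := by omega
      rw [hdn] at h1
      simp only [Fin.sum_univ_succ (n := d + 1), Fin.cons_zero, Fin.cons_succ]
      refine h1.trans (lintegral_mono fun z => ?_)
      gcongr
      exact le_add_of_nonneg_left (sq_nonneg _)

/-- The indicator function of `[1/4, 1]`; as a function of `|x|²` it describes the uniform
distribution on a spherical shell inside the unit ball. -/
noncomputable def shellWeight : ℝ → ℝ≥0∞ := (Set.Icc (1 / 4 : ℝ) 1).indicator 1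

theorem measurable_shellWeight : Measurable shellWeight :=
  measurable_one.indicator measurableSet_Icc

theorem lintegral_shellWeight_ne_zero {d : ℕ} (hd : 0 < d) :
    ∫⁻ x : Fin d → ℝ, shellWeight (∑ k, x k ^ 2) ≠ 0 := by
  have hU : IsOpen ((fun x : Fin d → ℝ => ∑ k, x k ^ 2) ⁻¹' Set.Ioo (1 / 4) 1) :=
    isOpen_Ioo.preimage (by fun_prop)
  have hne : ((fun x : Fin d → ℝ => ∑ k, x k ^ 2) ⁻¹' Set.Ioo (1 / 4) 1).Nonempty := by
    refine ⟨Pi.single ⟨0, hd⟩ (3 / 4), ?_⟩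
    have : ∑ k, (Pi.single ⟨0, hd⟩ (3 / 4) : Fin d → ℝ) k ^ 2 = 9 / 16 := by
      rw [Finset.sum_eq_single ⟨0, hd⟩ (fun k _ hk => by simp [Pi.single_eq_of_ne hk]) (by simp)]
      rw [Pi.single_eq_same]; norm_num
    rw [Set.mem_preimage, this]
    norm_num
  refine (lt_of_lt_of_le (hU.measure_pos volume hne) ?_).ne'
  rw [← lintegral_indicator_one hU.measurableSet]
  refine lintegral_mono fun x => ?_
  by_cases hx : ∑ k, x k ^ 2 ∈ Set.Ioo (1 / 4 : ℝ) 1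
  · rw [shellWeight, Set.indicator_of_mem (Set.Ioo_subset_Icc_self hx)]
    exact Set.indicator_le_self' (fun _ _ => zero_le) x
  · rw [Set.indicator_of_notMem (by exact hx)]
    exact zero_le

theorem lintegral_shellWeight_ne_top (d : ℕ) :
    ∫⁻ x : Fin d → ℝ, shellWeight (∑ k, x k ^ 2) ≠ ⊤ := by
  refine (lt_of_le_of_lt ?_ (measure_closedBall_lt_top (μ := (volume : Measure (Fin d → ℝ)))
    (x := 0) (r := 1))).ne
  rw [← lintegral_indicator_one Metric.isClosed_closedBall.measurableSet]
  refine lintegral_mono fun x => ?_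
  by_cases hx : ∑ k, x k ^ 2 ∈ Set.Icc (1 / 4 : ℝ) 1
  · have : x ∈ Metric.closedBall (0 : Fin d → ℝ) 1 := by
      rw [mem_closedBall_zero_iff, pi_norm_le_iff_of_nonneg zero_le_one]
      intro i
      have := (Finset.single_le_sum (fun k _ => sq_nonneg (x k)) (Finset.mem_univ i)).trans hx.2
      rwa [sq_le_one_iff_abs_le_one] at this
    rw [shellWeight, Set.indicator_of_mem hx, Set.indicator_of_mem this]
    rfl
  · rw [shellWeight, Set.indicator_of_notMem hx]
    exact zero_le

/-- The mean squared error of an algorithm that evaluates `2 * n` real functionals is at least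
`1 / 8` on the shell in dimension `4 * n`. -/
theorem IsDetAlg.lintegral_shellWeight_le {n : ℕ} (hn : 0 < n)
    {A : (Fin (4 * n) → ℝ) → (Fin (4 * n) → ℝ)} (hA : Measurable A)
    {Λ : Set ((Fin (4 * n) → ℝ) →ₗ[ℝ] ℝ)} (h : IsDetAlg Λ (2 * n) A) :
    ∫⁻ x : Fin (4 * n) → ℝ, shellWeight (∑ k, x k ^ 2) ≤
      8 * ∫⁻ x : Fin (4 * n) → ℝ, shellWeight (∑ k, x k ^ 2) *
        ENNReal.ofReal (∑ k, (x k - A x k) ^ 2) := by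
  have h1 := h.le_lintegral_radial _ measurable_shellWeight hA ⟨0, by omega⟩
  have h2 := lintegral_radial_mul_sum_sq measurable_shellWeight (⟨0, by omega⟩ : Fin (4 * n))
  have h3 : ∫⁻ x : Fin (4 * n) → ℝ, shellWeight (∑ k, x k ^ 2) ≤
      4 * ∫⁻ x : Fin (4 * n) → ℝ, shellWeight (∑ k, x k ^ 2) *
        ENNReal.ofReal (∑ k, x k ^ 2) := by
    rw [← lintegral_const_mul' _ _ (by simp)]
    refine lintegral_mono fun x => ?_
    by_cases hx : ∑ k, x k ^ 2 ∈ Set.Icc (1 / 4 : ℝ) 1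
    · rw [mul_left_comm]
      refine le_mul_of_one_le_right' ?_
      rw [← ENNReal.ofReal_ofNat 4, ← ENNReal.ofReal_mul (by norm_num), ENNReal.one_le_ofReal]
      linarith [hx.1]
    · rw [shellWeight, Set.indicator_of_notMem hx]
      exact zero_le
  have hn2 : 4 * n - 2 * n = 2 * n := by omega
  rw [hn2] at h1
  refine h3.trans ?_
  rw [← h2]
  refine le_trans (le_of_eq ?_) (mul_le_mul_right h1 8)
  push_cast
  ring

/-- If the mean squared error of randomized algorithms that evaluate `2 * n` real functionals of
`x ∈ ℝ^(4 * n)` is bounded by `E / c` on the unit ball, then `c ≤ 8 * E`. -/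
theorem IsDetAlg.le_of_forall_lintegral_le {Ω : Type*} [MeasurableSpace Ω] (P : Measure Ω)
    [IsProbabilityMeasure P] {n : ℕ} (hn : 0 < n)
    {r : Ω → (Fin (4 * n) → ℝ) → (Fin (4 * n) → ℝ)}
    (hr : Measurable fun p : (Fin (4 * n) → ℝ) × Ω => r p.2 p.1)
    {Λ : Set ((Fin (4 * n) → ℝ) →ₗ[ℝ] ℝ)} (hdet : ∀ ω, IsDetAlg Λ (2 * n) (r ω))
    {c E : ℝ≥0∞} (hc : c ≠ ⊤) (h : ∀ x : Fin (4 * n) → ℝ, ∑ k, x k ^ 2 ≤ 1 →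
      c * ∫⁻ ω, ENNReal.ofReal (∑ k, (x k - r ω x k) ^ 2) ∂P ≤ E) : c ≤ 8 * E := by
  obtain ⟨W, hW⟩ : ∃ W, W = ∫⁻ x : Fin (4 * n) → ℝ, shellWeight (∑ k, x k ^ 2) := ⟨_, rfl⟩
  obtain ⟨g, hg⟩ : ∃ g : (Fin (4 * n) → ℝ) → Ω → ℝ≥0∞, g = fun x ω =>
    ENNReal.ofReal (∑ k, (x k - r ω x k) ^ 2) := ⟨_, rfl⟩
  have hgm : Measurable fun p : (Fin (4 * n) → ℝ) × Ω => g p.1 p.2 := by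
    have hrk : ∀ k, Measurable fun p : (Fin (4 * n) → ℝ) × Ω => r p.2 p.1 k :=
      measurable_pi_iff.mp hr
    rw [hg]
    exact ENNReal.measurable_ofReal.comp (Finset.measurable_fun_sum _ fun k _ =>
      (((measurable_pi_apply k).comp measurable_fst).sub (hrk k)).pow_const 2)
  have hgω : ∀ x, Measurable (g x) := fun x => hgm.comp measurable_prodMk_left
  have hwm : Measurable fun x : Fin (4 * n) → ℝ => shellWeight (∑ k, x k ^ 2) := by
    have := measurable_shellWeight
    fun_prop
  have h1 : W ≤ ∫⁻ ω, 8 * (∫⁻ x : Fin (4 * n) → ℝ, shellWeight (∑ k, x k ^ 2) * g x ω) ∂P := by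
    calc W = ∫⁻ _ω : Ω, W ∂P := by simp
      _ ≤ _ := lintegral_mono fun ω => by
        rw [hW, hg]
        exact (hdet ω).lintegral_shellWeight_le hn (hr.comp measurable_prodMk_right)
  have h2 : ∫⁻ ω, (∫⁻ x : Fin (4 * n) → ℝ, shellWeight (∑ k, x k ^ 2) * g x ω) ∂P =
      ∫⁻ x : Fin (4 * n) → ℝ, shellWeight (∑ k, x k ^ 2) * ∫⁻ ω, g x ω ∂P := by
    rw [lintegral_lintegral_swap (f := fun ω x => shellWeight (∑ k, x k ^ 2) * g x ω)
      ((((hwm.comp measurable_fst).mul hgm).comp measurable_swap).aemeasurable)]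
    exact lintegral_congr fun x => lintegral_const_mul _ (hgω x)
  have h3 : c * ∫⁻ x : Fin (4 * n) → ℝ, shellWeight (∑ k, x k ^ 2) * ∫⁻ ω, g x ω ∂P ≤ E * W := by
    rw [← lintegral_const_mul' _ _ hc, hW, ← lintegral_const_mul _ hwm]
    refine lintegral_mono fun x => ?_
    by_cases hx : ∑ k, x k ^ 2 ∈ Set.Icc (1 / 4 : ℝ) 1
    · change c * (_ * _) ≤ E * _
      rw [mul_left_comm, mul_comm E, hg]
      gcongr
      exact h x hx.2
    · change c * (shellWeight _ * _) ≤ E * shellWeight _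
      rw [shellWeight, Set.indicator_of_notMem hx, zero_mul, mul_zero]
      exact zero_le
  have hW0 : W ≠ 0 := hW ▸ lintegral_shellWeight_ne_zero (by omega)
  have hWt : W ≠ ⊤ := hW ▸ lintegral_shellWeight_ne_top _
  rw [lintegral_const_mul' _ _ (by simp), h2] at h1
  refine (ENNReal.mul_le_mul_iff_left hW0 hWt).mp ?_
  calc c * W ≤ c * (8 * _) := by gcongr
    _ = 8 * (c * _) := mul_left_comm _ _ _
    _ ≤ 8 * (E * W) := by gcongr
    _ = 8 * E * W := (mul_assoc _ _ _).symm

/-! ### Errors and singular values -/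

section

variable {D : Type u} {K : Type w} [RCLike K] {F : Type v} {G : Type*}
    [NormedAddCommGroup F] [InnerProductSpace K F]
    [NormedAddCommGroup G] [InnerProductSpace K G] {T : F →L[K] G}
    {ev : F →ₗ[K] (D → K)} {Λ Λ' : Set (F →ₗ[K] K)} {n : ℕ}

theorem minRanError_mono_class (hΛ : Λ ⊆ Λ') : minRanError T ev Λ' n ≤ minRanError T ev Λ n := by
  refine le_iInf fun A => ?_
  exact iInf_le_of_le ⟨A.Ω, A.mΩ, A.P, A.isProb, A.out, fun ω => (A.isDetAlg ω).mono hΛ le_rfl,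
    A.isMeasurable⟩ le_rfl

/-- A deterministic algorithm with continuous output is a randomized algorithm. -/
theorem minRanError_le_detError {A : F → G} (hA : IsDetAlg Λ n A) (hc : Continuous A) :
    minRanError T ev Λ n ≤ detError T A := by
  have hm : IsMeasurableRandomized ev ⊤ fun _ : PUnit => A := by
    intro V _
    let : MeasurableSpace V := borel V
    have : BorelSpace V := ⟨rfl⟩
    let : MeasurableSpace G := borel G
    have : BorelSpace G := ⟨rfl⟩
    exact (hc.comp continuous_subtype_val).measurable.comp measurable_fst
  refine iInf_le_of_le ⟨PUnit, ⊤, Measure.dirac PUnit.unit, Measure.dirac.isProbabilityMeasure,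
    fun _ => A, fun _ => hA, hm⟩ (iSup₂_mono fun f _ => ?_)
  change (∫⁻ _, ‖T f - A f‖ₑ ^ 2 ∂(Measure.dirac PUnit.unit)) ^ (1 / 2 : ℝ) ≤ _
  rw [lintegral_const, measure_univ, mul_one, ← ENNReal.rpow_natCast, ← ENNReal.rpow_mul]
  norm_num

end

namespace SingularSystem

variable {D : Type u} {K : Type w} [RCLike K] {F : Type v} {G : Type*}
    [NormedAddCommGroup F] [InnerProductSpace K F] [CompleteSpace F]
    [NormedAddCommGroup G] [InnerProductSpace K G] [CompleteSpace G]
    {T : F →L[K] G} {e : ℕ → F} {s : ℕ → ℝ}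

theorem norm_map_sub_sum_le (h : SingularSystem T e s) (n : ℕ) (f : F) :
    ‖T (f - ∑ i : Fin n, inner K (e i) f • e i)‖ ≤ s n * ‖f‖ := by
  have hon : Orthonormal K fun i : Fin n => e i := h.orthonormal.comp _ Fin.val_injective
  have horth : ∀ i : Fin n, inner K (e i) (f - ∑ i : Fin n, inner K (e i) f • e i) = 0 := by
    intro i
    rw [inner_sub_right, hon.inner_right_fintype, sub_self]
  have h1 := h.norm_le n (f - ∑ i : Fin n, inner K (e i) f • e i) fun i hi => horth ⟨i, hi⟩
  have h2 : inner K (∑ i : Fin n, inner K (e i) f • e i)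
      (f - ∑ i : Fin n, inner K (e i) f • e i) = 0 := by
    rw [sum_inner]
    exact Finset.sum_eq_zero fun i _ => by rw [inner_smul_left, horth, mul_zero]
  have h3 := norm_add_sq_eq_norm_sq_add_norm_sq_of_inner_eq_zero _ _ h2
  rw [add_sub_cancel] at h3
  have h4 : ‖f - ∑ i : Fin n, inner K (e i) f • e i‖ ≤ ‖f‖ :=
    le_of_sq_le_sq (by nlinarith [norm_nonneg (∑ i : Fin n, inner K (e i) f • e i)])
      (norm_nonneg _)
  exact h1.trans (mul_le_mul_of_nonneg_left h4 (h.pos n).le)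

/-- The optimal linear algorithm: orthogonal projection onto the leading singular vectors. -/
theorem exists_linear_algorithm (h : SingularSystem T e s) (n : ℕ) :
    ∃ A : F → G, IsDetAlg (lambdaAll K F) n A ∧ Continuous A ∧
      detError T A ≤ ENNReal.ofReal (s n) := by
  refine ⟨fun f => ∑ i : Fin n, inner K (e i) f • T (e i),
    IsDetAlg.of_values (fun i : Fin n => innerₛₗ K (e i)) (fun _ => Set.mem_univ _)
      fun y => ∑ i : Fin n, y i • T (e i), by fun_prop, iSup₂_le fun f hf => ?_⟩
  have h1 := h.norm_map_sub_sum_le n f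
  simp only [map_sub, map_sum, map_smul] at h1
  rw [← ofReal_norm]
  exact ENNReal.ofReal_le_ofReal (h1.trans (mul_le_of_le_one_right (h.pos n).le hf))

theorem minDetError_le (h : SingularSystem T e s) (n : ℕ) :
    minDetError T (lambdaAll K F) n ≤ ENNReal.ofReal (s n) := by
  obtain ⟨A, hA, _, hle⟩ := h.exists_linear_algorithm n
  exact iInf₂_le_of_le A hA hle

theorem minRanError_le (h : SingularSystem T e s) (ev : F →ₗ[K] (D → K)) (n : ℕ) :
    minRanError T ev (lambdaAll K F) n ≤ ENNReal.ofReal (s n) := by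
  obtain ⟨A, hA, hc, hle⟩ := h.exists_linear_algorithm n
  exact (minRanError_le_detError hA hc).trans hle

theorem le_norm_map_sum (h : SingularSystem T e s) (n : ℕ) (c : Fin (n + 1) → K) :
    s n * ‖∑ i : Fin (n + 1), c i • e i‖ ≤ ‖T (∑ i : Fin (n + 1), c i • e i)‖ := by
  have hon : Orthonormal K fun i : Fin (n + 1) => e i := h.orthonormal.comp _ Fin.val_injective
  refine le_of_sq_le_sq ?_ (norm_nonneg _)
  rw [mul_pow, hon.norm_sum_smul_sq]
  exact mul_sum_norm_sq_le_norm_map_sum hon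
    (fun i => pow_le_pow_left₀ (h.pos n).le (h.antitone (Nat.lt_succ_iff.mp i.2)) 2)
    (fun i => h.eigen i) c

/-- No deterministic algorithm beats the singular values: on some unit vector `f` with large `T f`,
the algorithm gives the same output for `f` and `-f`. -/
theorem le_minDetError (h : SingularSystem T e s) (Λ : Set (F →ₗ[K] K)) (n : ℕ) :
    ENNReal.ofReal (s n) ≤ minDetError T Λ n := by
  refine le_iInf₂ fun A hA => ?_
  obtain ⟨L, hL⟩ := hA.exists_forall_eq_map_zero
  have hon : Orthonormal K fun i : Fin (n + 1) => e i := h.orthonormal.comp _ Fin.val_injective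
  obtain ⟨c, hc0, hc⟩ := exists_ne_zero_forall_linear_eq_zero
    fun i => (L i).comp (Fintype.linearCombination K fun i : Fin (n + 1) => e i)
  simp only [LinearMap.comp_apply, Fintype.linearCombination_apply] at hc
  have h1 := h.le_norm_map_sum n c
  obtain ⟨g, hg⟩ : ∃ g, g = ∑ i : Fin (n + 1), c i • e i := ⟨_, rfl⟩
  rw [← hg] at h1
  simp only [← hg] at hc
  have hg0 : 0 < ‖g‖ := by
    rw [norm_pos_iff]
    rintro rfl
    exact hc0 (funext fun i => Fintype.linearIndependent_iff.mp hon.linearIndependent c hg.symm i)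
  obtain ⟨f, hf⟩ : ∃ f, f = ((‖g‖⁻¹ : ℝ) : K) • g := ⟨_, rfl⟩
  have hfn : ‖f‖ = 1 := by
    rw [hf, norm_smul, RCLike.norm_ofReal, abs_of_pos (by positivity), inv_mul_cancel₀ hg0.ne']
  have hTf : s n ≤ ‖T f‖ := by
    rw [hf, map_smul, norm_smul, RCLike.norm_ofReal, abs_of_pos (by positivity),
      inv_mul_eq_div, le_div_iff₀ hg0]
    exact h1
  have hAf : A f = A 0 := hL f fun i => by rw [hf, map_smul, hc, smul_zero]
  have hAf' : A (-f) = A 0 := hL (-f) fun i => by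
    rw [map_neg, hf, map_smul, hc, smul_zero, neg_zero]
  have hmax : s n ≤ ‖T f - A f‖ ∨ s n ≤ ‖T (-f) - A (-f)‖ := by
    by_contra! hcon
    rw [hAf, hAf', map_neg] at hcon
    have h2 : ‖(T f - A 0) - (-T f - A 0)‖ ≤ ‖T f - A 0‖ + ‖-T f - A 0‖ := norm_sub_le _ _
    have h3 : (T f - A 0) - (-T f - A 0) = (2 : K) • T f := by rw [two_smul]; abel
    rw [h3, norm_smul, RCLike.norm_ofNat] at h2
    linarith [hcon.1, hcon.2]
  rcases hmax with h2 | h2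
  · refine le_trans ?_ (le_iSup₂ (f := fun f (_ : ‖f‖ ≤ 1) => ‖T f - A f‖ₑ) f hfn.le)
    rw [← ofReal_norm]
    exact ENNReal.ofReal_le_ofReal h2
  · refine le_trans ?_ (le_iSup₂ (f := fun f (_ : ‖f‖ ≤ 1) => ‖T f - A f‖ₑ) (-f)
      (by rw [norm_neg, hfn]))
    rw [← ofReal_norm]
    exact ENNReal.ofReal_le_ofReal h2

/-- Randomization improves the error of optimal algorithms at most up to constants: the worst case
error is at least the average error over a spherical shell in the span of the first `4 * n`
singular vectors. -/
theorem le_minRanError (h : SingularSystem T e s) (ev : F →ₗ[K] (D → K)) (Λ : Set (F →ₗ[K] K))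
    {n : ℕ} (hn : 0 < n) : ENNReal.ofReal (s (4 * n)) ≤ 3 * minRanError T ev Λ n := by
  rw [minRanError, ENNReal.mul_iInf_of_ne (by simp) (by simp)]
  refine le_iInf fun A => ?_
  let := A.mΩ
  have := A.isProb
  let ι : (Fin (4 * n) → ℝ) →+ F :=
    { toFun := fun x => ∑ i, ((x i : ℝ) : K) • e i
      map_zero' := by simp
      map_add' := fun x y => by simp [add_smul, Finset.sum_add_distrib] }
  have hιapp : ∀ x, ι x = ∑ i, ((x i : ℝ) : K) • e i := fun _ => rfl
  have hon : Orthonormal K fun i : Fin (4 * n) => e i := h.orthonormal.comp _ Fin.val_injective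
  have hιn : ∀ x, ‖ι x‖ ^ 2 = ∑ i, x i ^ 2 := by
    intro x
    rw [hιapp, hon.norm_sum_smul_sq]
    simp
  -- the coordinates of the output in the image of `ι`
  let r : A.Ω → (Fin (4 * n) → ℝ) → (Fin (4 * n) → ℝ) := fun ω x i =>
    RCLike.re (inner K (T (e i)) (A.out ω (ι x))) / s i ^ 2
  have hr : Measurable fun p : (Fin (4 * n) → ℝ) × A.Ω => r p.2 p.1 := by
    let V : Submodule K F := Submodule.span K (Set.range fun i : Fin (4 * n) => e i)
    have : FiniteDimensional K V := FiniteDimensional.span_of_finite K (Set.finite_range _)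
    have hmeas := A.isMeasurable V fun x =>
      LinearMap.continuous_of_finiteDimensional
        ((LinearMap.proj (R := K) (φ := fun _ : D => K) x).comp (ev.comp V.subtype))
    let : MeasurableSpace V := borel V
    have : BorelSpace V := ⟨rfl⟩
    let : MeasurableSpace G := borel G
    have : BorelSpace G := ⟨rfl⟩
    have hιV : ∀ x, ι x ∈ V := fun x => hιapp x ▸
      V.sum_mem fun i _ => V.smul_mem _ (Submodule.subset_span (Set.mem_range_self i))
    have hι0 : Continuous fun x : Fin (4 * n) → ℝ => ∑ i, ((x i : ℝ) : K) • e i := by fun_prop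
    have hιc : Continuous fun x => (⟨ι x, hιV x⟩ : V) := hι0.subtype_mk hιV
    have h1 : Measurable fun p : (Fin (4 * n) → ℝ) × A.Ω => A.out p.2 (ι p.1) :=
      hmeas.comp ((hιc.measurable.comp measurable_fst).prodMk measurable_snd)
    refine measurable_pi_iff.mpr fun i => ?_
    have h2 : Continuous fun g : G => RCLike.re (inner K (T (e i)) g) / s i ^ 2 := by fun_prop
    exact h2.measurable.comp h1
  have hdet : ∀ ω, IsDetAlg (Set.univ : Set ((Fin (4 * n) → ℝ) →ₗ[ℝ] ℝ)) (2 * n) (r ω) := fun ω =>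
    ((A.isDetAlg ω).restrict_real ι fun c x => by
      simp [hιapp, Finset.smul_sum, smul_smul]).map fun g (i : Fin (4 * n)) =>
        RCLike.re (inner K (T (e i)) g) / s i ^ 2
  have hpt : ∀ ω x, ENNReal.ofReal (s (4 * n) ^ 2) * ENNReal.ofReal (∑ k, (x k - r ω x k) ^ 2) ≤
      ‖T (ι x) - A.out ω (ι x)‖ₑ ^ 2 := by
    intro ω x
    rw [← ENNReal.ofReal_mul (sq_nonneg _), ← ofReal_norm,
      ← ENNReal.ofReal_pow (norm_nonneg _)]
    refine ENNReal.ofReal_le_ofReal ?_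
    have h1 := (h.orthonormal_left.comp (fun i : Fin (4 * n) => (i : ℕ))
      Fin.val_injective).sum_inner_products_le (T (ι x) - A.out ω (ι x)) (s := Finset.univ)
    refine le_trans ?_ h1
    rw [Finset.mul_sum]
    refine Finset.sum_le_sum fun i _ => ?_
    simp only [Function.comp_apply]
    have hsi := h.pos i
    have h2 : RCLike.re (inner K ((((s i)⁻¹ : ℝ) : K) • T (e i)) (T (ι x) - A.out ω (ι x))) =
        s i * (x i - r ω x i) := by
      rw [inner_smul_left, RCLike.conj_ofReal, RCLike.re_ofReal_mul, inner_sub_right,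
        h.inner_map_map, hιapp, hon.inner_right_fintype, ← RCLike.ofReal_mul, map_sub,
        RCLike.ofReal_re]
      simp only [r, hιapp]
      field_simp
    have h3 := RCLike.abs_re_le_norm
      (inner K ((((s i)⁻¹ : ℝ) : K) • T (e i)) (T (ι x) - A.out ω (ι x)))
    rw [h2] at h3
    calc s (4 * n) ^ 2 * (x i - r ω x i) ^ 2 ≤ s i ^ 2 * (x i - r ω x i) ^ 2 := by
          have := pow_le_pow_left₀ (h.pos (4 * n)).le (h.antitone i.2.le) 2
          gcongr
      _ = |s i * (x i - r ω x i)| ^ 2 := by rw [sq_abs, mul_pow]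
      _ ≤ _ := pow_le_pow_left₀ (abs_nonneg _) h3 2
  have hsup : ∀ x, ∑ k, x k ^ 2 ≤ 1 →
      ∫⁻ ω, ‖T (ι x) - A.out ω (ι x)‖ₑ ^ 2 ∂A.P ≤ ranError T A ^ 2 := by
    intro x hx
    have h1 : ‖ι x‖ ≤ 1 := by
      rw [← hιn] at hx
      exact (sq_le_one_iff₀ (norm_nonneg _)).mp hx
    have h2 : (∫⁻ ω, ‖T (ι x) - A.out ω (ι x)‖ₑ ^ 2 ∂A.P) ^ (1 / 2 : ℝ) ≤ ranError T A :=
      le_iSup₂ (f := fun f (_ : ‖f‖ ≤ 1) =>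
        (∫⁻ ω, ‖T f - A.out ω f‖ₑ ^ 2 ∂A.P) ^ (1 / 2 : ℝ)) (ι x) h1
    have h3 := ENNReal.rpow_le_rpow h2 (z := 2) (by norm_num)
    rw [← ENNReal.rpow_mul] at h3
    norm_num at h3
    exact h3
  have h1 := IsDetAlg.le_of_forall_lintegral_le A.P hn hr hdet
    (c := ENNReal.ofReal (s (4 * n) ^ 2)) ENNReal.ofReal_ne_top fun x hx => by
      rw [← lintegral_const_mul' _ _ ENNReal.ofReal_ne_top]
      exact (lintegral_mono fun ω => hpt ω x).trans (hsup x hx)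
  rw [ENNReal.ofReal_pow (h.pos _).le] at h1
  refine (ENNReal.pow_le_pow_left_iff two_ne_zero).mp (h1.trans ?_)
  rw [mul_pow]
  gcongr
  norm_num

end SingularSystem

/-! ### One step of the Monte Carlo method -/

section

variable {D : Type u} {K : Type w} [RCLike K]

/-- The density `(|b 0|² + ⋯ + |b (m - 1)|²) / m` of the sampling distribution. -/
noncomputable def samplingDensity (b : ℕ → D → K) (m : ℕ) (x : D) : ℝ≥0 :=
  (m : ℝ≥0)⁻¹ * ∑ j : Fin m, ‖b j x‖₊ ^ 2

theorem coe_samplingDensity (b : ℕ → D → K) (m : ℕ) (x : D) :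
    (samplingDensity b m x : ℝ) = (m : ℝ)⁻¹ * ∑ j : Fin m, ‖b j x‖ ^ 2 := by
  simp [samplingDensity]

variable [MeasurableSpace D] {μ : Measure D}

theorem measurable_samplingDensity {b : ℕ → D → K} (hb : ∀ j, Measurable (b j)) (m : ℕ) :
    Measurable (samplingDensity b m) := by
  unfold samplingDensity
  fun_prop

theorem integrable_norm_sq_of_ae_eq {H : Lp K 2 μ} {h : D → K} (hH : H =ᵐ[μ] h) :
    Integrable (fun x => ‖h x‖ ^ 2) μ := by
  have h1 : MemLp h 2 μ := (memLp_congr_ae hH).mp (Lp.memLp H)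
  exact (memLp_two_iff_integrable_sq_norm h1.1).mp h1

theorem integral_norm_sq_of_ae_eq {H : Lp K 2 μ} {h : D → K} (hH : H =ᵐ[μ] h) :
    ∫ x, ‖h x‖ ^ 2 ∂μ = ‖H‖ ^ 2 := by
  have h1 : ((‖H‖ ^ 2 : ℝ) : K) = ((∫ x, ‖h x‖ ^ 2 ∂μ : ℝ) : K) := by
    push_cast
    rw [← inner_self_eq_norm_sq_to_K, L2.inner_def, ← integral_ofReal]
    refine integral_congr_ae ?_
    filter_upwards [hH] with x hx
    rw [hx, inner_self_eq_norm_sq_to_K]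
    push_cast; rfl
  exact_mod_cast h1.symm

theorem integrable_conj_mul_of_ae_eq {H H' : Lp K 2 μ} {h h' : D → K} (hH : H =ᵐ[μ] h)
    (hH' : H' =ᵐ[μ] h') : Integrable (fun x => starRingEnd K (h x) * h' x) μ := by
  refine (L2.integrable_inner (𝕜 := K) H H').congr ?_
  filter_upwards [hH, hH'] with x hx hx'
  rw [hx, hx', RCLike.inner_apply, mul_comm]

theorem integral_conj_mul_of_ae_eq {H H' : Lp K 2 μ} {h h' : D → K} (hH : H =ᵐ[μ] h)
    (hH' : H' =ᵐ[μ] h') : ∫ x, starRingEnd K (h x) * h' x ∂μ = inner K H H' := by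
  rw [L2.inner_def]
  refine integral_congr_ae ?_
  filter_upwards [hH, hH'] with x hx hx'
  rw [hx, hx', RCLike.inner_apply, mul_comm]

theorem integrable_samplingDensity {b : ℕ → D → K} {B : ℕ → Lp K 2 μ}
    (hBb : ∀ j, B j =ᵐ[μ] b j) (m : ℕ) : Integrable (fun x => (samplingDensity b m x : ℝ)) μ := by
  simp only [coe_samplingDensity]
  exact (integrable_finsetSum _ fun (j : Fin m) _ =>
    integrable_norm_sq_of_ae_eq (hBb j)).const_mul _

theorem integral_samplingDensity {b : ℕ → D → K} {B : ℕ → Lp K 2 μ} (hB : Orthonormal K B)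
    (hBb : ∀ j, B j =ᵐ[μ] b j) {m : ℕ} (hm : 0 < m) :
    ∫ x, (samplingDensity b m x : ℝ) ∂μ = 1 := by
  simp only [coe_samplingDensity]
  rw [integral_const_mul, integral_finsetSum _ fun (j : Fin m) _ =>
    integrable_norm_sq_of_ae_eq (hBb j)]
  have : (m : ℝ) ≠ 0 := (Nat.cast_pos.mpr hm).ne'
  simp [integral_norm_sq_of_ae_eq (hBb _), hB.1, this]

theorem isProbabilityMeasure_samplingDensity {b : ℕ → D → K} {B : ℕ → Lp K 2 μ}
    (hB : Orthonormal K B) (hBb : ∀ j, B j =ᵐ[μ] b j) {m : ℕ} (hm : 0 < m) :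
    IsProbabilityMeasure (μ.withDensity fun x => samplingDensity b m x) := by
  constructor
  rw [withDensity_apply _ MeasurableSet.univ, Measure.restrict_univ,
    lintegral_coe_eq_integral _ (integrable_samplingDensity hBb m),
    integral_samplingDensity hB hBb hm, ENNReal.ofReal_one]

/-- The coefficient of `b j` in the unbiased estimator, from the value `y` of a function at one
sample point `x`, of the orthogonal projection of the function onto the span of
`b 0, …, b (m - 1)`.
At points of vanishing density, which are never sampled, the division by zero gives `0`. -/
noncomputable def sampleCoeff (b : ℕ → D → K) (m : ℕ) (x : D) (y : K) (j : ℕ) : K :=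
  starRingEnd K (b j x) * y / ((samplingDensity b m x : ℝ) : K)

/-- The mean squared error after subtracting `1 / m` times the one-sample estimator of the
orthogonal projection. -/
theorem lintegral_enorm_sub_sample_le {b : ℕ → D → K} (hb : ∀ j, Measurable (b j))
    {B : ℕ → Lp K 2 μ} (hB : Orthonormal K B) (hBb : ∀ j, B j =ᵐ[μ] b j) {m : ℕ} (hm : 0 < m)
    {H : Lp K 2 μ} {h : D → K} (hH : H =ᵐ[μ] h) :
    ∫⁻ x, ‖H - (m : K)⁻¹ • ∑ j : Fin m, sampleCoeff b m x (h x) j • B j‖ₑ ^ 2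
        ∂(μ.withDensity fun x => samplingDensity b m x) ≤
      ENNReal.ofReal ((1 + (m : ℝ)⁻¹) * ‖H‖ ^ 2 -
        2 * (m : ℝ)⁻¹ * ∑ j : Fin m, ‖inner K (B j) H‖ ^ 2) := by
  have hm' : (0 : ℝ) < m := Nat.cast_pos.mpr hm
  have hon : Orthonormal K fun j : Fin m => B j := hB.comp _ Fin.val_injective
  let ψ : D → ℝ := fun x => samplingDensity b m x * ‖H‖ ^ 2 + (m : ℝ)⁻¹ * ‖h x‖ ^ 2 -
    2 * (m : ℝ)⁻¹ * RCLike.re (∑ j : Fin m, starRingEnd K (b j x) * h x * inner K H (B j))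
  have hψ : ∀ x, samplingDensity b m x *
      ‖H - (m : K)⁻¹ • ∑ j : Fin m, sampleCoeff b m x (h x) j • B j‖ ^ 2 ≤ ψ x := by
    intro x
    obtain ⟨ρ, hρ⟩ : ∃ ρ : ℝ, ρ = samplingDensity b m x := ⟨_, rfl⟩
    have hsum : ∑ j : Fin m, ‖b j x‖ ^ 2 = m * ρ := by
      rw [hρ, coe_samplingDensity]; field_simp
    simp only [ψ, sampleCoeff, ← hρ]
    by_cases hρ0 : ρ = 0
    · have hbj : ∀ j : Fin m, b j x = 0 := by
        intro j
        rw [hρ0, mul_zero, Finset.sum_eq_zero_iff_of_nonneg fun j _ => by positivity] at hsum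
        simpa using hsum j (Finset.mem_univ j)
      simp only [hρ0, hbj, zero_mul, map_zero, Finset.sum_const_zero, mul_zero, zero_add, sub_zero]
      positivity
    · rw [norm_sub_sq (𝕜 := K), norm_smul, mul_pow, hon.norm_sum_smul_sq, inner_smul_right,
        inner_sum]
      have h1 : RCLike.re ((m : K)⁻¹ * ∑ j : Fin m, inner K H
          ((starRingEnd K (b j x) * h x / (ρ : K)) • B j)) = (m : ℝ)⁻¹ * ρ⁻¹ *
          RCLike.re (∑ j : Fin m, starRingEnd K (b j x) * h x * inner K H (B j)) := by
        rw [← RCLike.re_ofReal_mul]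
        congr 1
        push_cast
        rw [mul_assoc, Finset.mul_sum (a := (ρ : K)⁻¹)]
        congr 1
        refine Finset.sum_congr rfl fun j _ => ?_
        rw [inner_smul_right]
        ring
      have h2 : ∑ j : Fin m, ‖starRingEnd K (b j x) * h x / (ρ : K)‖ ^ 2 = m * ‖h x‖ ^ 2 / ρ := by
        have : ∀ j : Fin m, ‖starRingEnd K (b j x) * h x / (ρ : K)‖ ^ 2 =
            ‖b j x‖ ^ 2 * (‖h x‖ ^ 2 / ρ ^ 2) := by
          intro j
          rw [norm_div, norm_mul, RCLike.norm_conj, RCLike.norm_ofReal, div_pow, sq_abs, mul_pow,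
            mul_div_assoc]
        simp only [this]
        rw [← Finset.sum_mul, hsum]
        field_simp
      rw [h1, h2, norm_inv, RCLike.norm_natCast]
      refine le_of_eq ?_
      generalize RCLike.re (∑ j : Fin m, starRingEnd K (b j x) * h x * inner K H (B j)) = R
      field_simp
      ring
  have hi : ∀ j, Integrable (fun x => starRingEnd K (b j x) * h x * inner K H (B j)) μ :=
    fun j => (integrable_conj_mul_of_ae_eq (hBb j) hH).mul_const _
  have hi2 : Integrable (fun x => ∑ j : Fin m, starRingEnd K (b j x) * h x * inner K H (B j)) μ :=
    integrable_finsetSum _ fun j _ => hi j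
  have hi1 := (integrable_samplingDensity hBb m).mul_const (‖H‖ ^ 2)
  have hi3 := (integrable_norm_sq_of_ae_eq hH).const_mul (m : ℝ)⁻¹
  have hi4 := hi2.re.const_mul (2 * (m : ℝ)⁻¹)
  have hψi : Integrable ψ μ := (hi1.add hi3).sub hi4
  have hψ0 : ∀ x, 0 ≤ ψ x := fun x =>
    (mul_nonneg NNReal.zero_le_coe (sq_nonneg _)).trans (hψ x)
  have hψint : ∫ x, ψ x ∂μ = (1 + (m : ℝ)⁻¹) * ‖H‖ ^ 2 -
      2 * (m : ℝ)⁻¹ * ∑ j : Fin m, ‖inner K (B j) H‖ ^ 2 := by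
    have h1 : ∫ x, RCLike.re (∑ j : Fin m, starRingEnd K (b j x) * h x * inner K H (B j)) ∂μ =
        ∑ j : Fin m, ‖inner K (B j) H‖ ^ 2 := by
      rw [integral_re hi2, integral_finsetSum _ fun (j : Fin m) _ => hi j, map_sum]
      refine Finset.sum_congr rfl fun j _ => ?_
      rw [integral_mul_const, integral_conj_mul_of_ae_eq (hBb j) hH, ← inner_conj_symm H,
        RCLike.mul_conj, ← RCLike.ofReal_pow, RCLike.ofReal_re]
    have hi13 : Integrable (fun x => samplingDensity b m x * ‖H‖ ^ 2 + (m : ℝ)⁻¹ * ‖h x‖ ^ 2) μ :=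
      hi1.add hi3
    change ∫ x, (samplingDensity b m x * ‖H‖ ^ 2 + (m : ℝ)⁻¹ * ‖h x‖ ^ 2 - 2 * (m : ℝ)⁻¹ *
      RCLike.re (∑ j : Fin m, starRingEnd K (b j x) * h x * inner K H (B j))) ∂μ = _
    rw [integral_sub hi13 hi4, integral_add hi1 hi3, integral_mul_const,
      integral_const_mul, integral_const_mul, h1, integral_samplingDensity hB hBb hm,
      integral_norm_sq_of_ae_eq hH]
    ring
  calc _ ≤ ∫⁻ x, (samplingDensity b m x : ℝ≥0∞) *
        ‖H - (m : K)⁻¹ • ∑ j : Fin m, sampleCoeff b m x (h x) j • B j‖ₑ ^ 2 ∂μ :=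
        lintegral_withDensity_le_lintegral_mul μ
          (measurable_samplingDensity hb m).coe_nnreal_ennreal _
    _ ≤ ∫⁻ x, ENNReal.ofReal (ψ x) ∂μ := by
        refine lintegral_mono fun x => ?_
        rw [← ofReal_norm, ← ENNReal.ofReal_pow (norm_nonneg _), ← ENNReal.ofReal_coe_nnreal,
          ← ENNReal.ofReal_mul NNReal.zero_le_coe]
        exact ENNReal.ofReal_le_ofReal (hψ x)
    _ = _ := by rw [← ofReal_integral_eq_lintegral_ofReal hψi (ae_of_all _ hψ0), hψint]

end

/-! ### The iterated Monte Carlo method -/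

theorem Orthonormal.eq_sum_inner_smul_of_mem_span {K : Type*} [RCLike K] {F : Type*}
    [NormedAddCommGroup F] [InnerProductSpace K F] {ι : Type*} [Fintype ι] {g : ι → F}
    (hg : Orthonormal K g) {a : F} (ha : a ∈ Submodule.span K (Set.range g)) :
    ∑ i, inner K (g i) a • g i = a := by
  obtain ⟨c, rfl⟩ := (Submodule.mem_span_range_iff_exists_fun K).mp ha
  exact Finset.sum_congr rfl fun i _ => by rw [hg.inner_right_fintype]

section

variable {D : Type u} [MeasurableSpace D] {μ : Measure D} {K : Type w} [RCLike K]
    {F : Type v} [NormedAddCommGroup F] [InnerProductSpace K F]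

/-- There is a measurable randomized algorithm that evaluates `n` function values, has its output
in the span of `e 0, …, e (m - 1)`, and has a mean squared error of at most `r` on the unit ball. -/
def HasMonteCarlo (ev : F →ₗ[K] (D → K)) (T : F →L[K] Lp K 2 μ) (e : ℕ → F) (n m : ℕ) (r : ℝ) :
    Prop :=
  ∃ (Ω : Type u) (mΩ : MeasurableSpace Ω) (P : Measure Ω) (_ : IsProbabilityMeasure P)
    (a : Ω → F → F), (∀ ω, IsDetAlg (lambdaStd ev) n (a ω)) ∧
      (∀ ω f, a ω f ∈ Submodule.span K (Set.range fun i : Fin m => e i)) ∧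
      IsMeasurableRandomized ev mΩ a ∧
      ∀ f, ‖f‖ ≤ 1 → ∫⁻ ω, ‖T f - T (a ω f)‖ₑ ^ 2 ∂P ≤ ENNReal.ofReal r

namespace HasMonteCarlo

variable {ev : F →ₗ[K] (D → K)} {T : F →L[K] Lp K 2 μ} {e : ℕ → F} {n n' m m' : ℕ} {r r' : ℝ}

theorem mono (h : HasMonteCarlo ev T e n m r) (hn : n ≤ n') (hm : m ≤ m') (hr : r ≤ r') :
    HasMonteCarlo ev T e n' m' r' := by
  obtain ⟨Ω, mΩ, P, hP, a, hdet, hspan, hmeas, herr⟩ := h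
  refine ⟨Ω, mΩ, P, hP, a, fun ω => (hdet ω).mono subset_rfl hn, fun ω f =>
    Submodule.span_mono ?_ (hspan ω f), hmeas, fun f hf =>
      (herr f hf).trans (ENNReal.ofReal_le_ofReal hr)⟩
  rintro _ ⟨i, rfl⟩
  exact ⟨Fin.castLE hm i, rfl⟩

theorem zero {c : ℝ} (hc : ∀ f, ‖T f‖ ≤ c * ‖f‖) (hc0 : 0 ≤ c) :
    HasMonteCarlo ev T e 0 0 (c ^ 2) := by
  refine ⟨PUnit, ⊤, Measure.dirac PUnit.unit, Measure.dirac.isProbabilityMeasure, fun _ _ => 0,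
    fun _ => IsDetAlg.const 0 0, fun _ _ => Submodule.zero_mem _, fun V _ => measurable_const,
    fun f hf => ?_⟩
  rw [lintegral_const, measure_univ, mul_one, map_zero, sub_zero, ← ofReal_norm,
    ← ENNReal.ofReal_pow (norm_nonneg _)]
  exact ENNReal.ofReal_le_ofReal (pow_le_pow_left₀ (norm_nonneg _)
    ((hc f).trans (mul_le_of_le_one_right hc0 hf)) 2)

theorem minRanError_le (h : HasMonteCarlo ev T e n m (r ^ 2)) (hr : 0 ≤ r) :
    minRanError T ev (lambdaStd ev) n ≤ ENNReal.ofReal r := by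
  obtain ⟨Ω, mΩ, P, hP, a, hdet, hspan, hmeas, herr⟩ := h
  have hm : IsMeasurableRandomized ev mΩ fun ω f => T (a ω f) := by
    intro V hV
    have h1 := hmeas V hV
    let : MeasurableSpace F := borel F
    have : BorelSpace F := ⟨rfl⟩
    let : MeasurableSpace (Lp K 2 μ) := borel (Lp K 2 μ)
    have : BorelSpace (Lp K 2 μ) := ⟨rfl⟩
    exact T.continuous.measurable.comp h1
  refine iInf_le_of_le ⟨Ω, mΩ, P, hP, fun ω f => T (a ω f), fun ω => (hdet ω).map T, hm⟩
    (iSup₂_le fun f hf => ?_)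
  change (∫⁻ ω, ‖T f - T (a ω f)‖ₑ ^ 2 ∂P) ^ (1 / 2 : ℝ) ≤ _
  refine (ENNReal.rpow_le_rpow (herr f hf) (by norm_num)).trans ?_
  rw [ENNReal.ofReal_pow hr, ← ENNReal.rpow_natCast, ← ENNReal.rpow_mul]
  norm_num

variable [CompleteSpace F] {s : ℕ → ℝ}

/-- One further sample reduces the mean squared error by the factor `1 - 1 / m`, up to the
contribution of the part of `f` outside the span of the first `m` singular vectors. -/
theorem step [SecondCountableTopology F] (hS : SingularSystem T e s)
    (hev : ∀ f, Measurable (ev f)) (hTev : ∀ f, T f =ᵐ[μ] ev f)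
    (h : HasMonteCarlo ev T e n m r) (hm : 0 < m) (hr : 0 ≤ r) :
    HasMonteCarlo ev T e (n + 1) m ((1 - (m : ℝ)⁻¹) * r + 2 * (m : ℝ)⁻¹ * s m ^ 2) := by
  obtain ⟨Ω, mΩ, P, hP, a, hdet, hspan, hmeas, herr⟩ := h
  have hm1 : (1 : ℝ) ≤ m := Nat.one_le_cast.mpr hm
  have hm2 : 0 ≤ 1 - (m : ℝ)⁻¹ := sub_nonneg.mpr (inv_le_one_of_one_le₀ hm1)
  obtain ⟨b, hbdef⟩ : ∃ b : ℕ → D → K, b = fun j x => (((s j)⁻¹ : ℝ) : K) * ev (e j) x := ⟨_, rfl⟩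
  obtain ⟨B, hBdef⟩ : ∃ B : ℕ → Lp K 2 μ, B = fun j => (((s j)⁻¹ : ℝ) : K) • T (e j) := ⟨_, rfl⟩
  have hb : ∀ j, Measurable (b j) := fun j => by rw [hbdef]; exact (hev (e j)).const_mul _
  have hB : Orthonormal K B := hBdef ▸ hS.orthonormal_left
  have hBb : ∀ j, B j =ᵐ[μ] b j := by
    intro j
    rw [hbdef, hBdef]
    filter_upwards [Lp.coeFn_smul (((s j)⁻¹ : ℝ) : K) (T (e j)), hTev (e j)] with x h1 h2
    rw [h1, Pi.smul_apply, h2, smul_eq_mul]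
  have hQ := isProbabilityMeasure_samplingDensity hB hBb hm
  obtain ⟨Q, hQdef⟩ : ∃ Q, Q = μ.withDensity fun x => samplingDensity b m x := ⟨_, rfl⟩
  rw [← hQdef] at hQ
  -- the correction of the output `g` from the value `y` of the input at the point `x`
  let upd : D → F → K → F := fun x g y => g + (m : K)⁻¹ • ∑ j : Fin m,
    (sampleCoeff b m x (y - ev g x) j * (((s j)⁻¹ : ℝ) : K)) • e j
  have hon : Orthonormal K fun i : Fin m => e i := hS.orthonormal.comp _ Fin.val_injective
  refine ⟨Ω × D, inferInstance, P.prod Q, inferInstance,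
    fun p f => upd p.2 (a p.1 f) (ev f p.2), fun p => ?_, fun p f => ?_, fun V hV => ?_,
    fun f hf => ?_⟩
  · exact (hdet p.1).append (L := (LinearMap.proj p.2).comp ev) ⟨p.2, fun _ => rfl⟩ (upd p.2)
  · exact Submodule.add_mem _ (hspan _ _) (Submodule.smul_mem _ _ (Submodule.sum_mem _ fun j _ =>
      Submodule.smul_mem _ _ (Submodule.subset_span ⟨j, rfl⟩)))
  · have h1 := hmeas V hV
    let : MeasurableSpace V := borel V
    have : BorelSpace V := ⟨rfl⟩
    let : MeasurableSpace F := borel F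
    have : BorelSpace F := ⟨rfl⟩
    have h2 : Measurable fun p : V × D => ev (p.1 : F) p.2 :=
      measurable_uncurry_of_continuous_of_measurable (u := fun (f : V) x => ev (f : F) x)
        hV fun f => hev f
    have h3 : Measurable fun p : V × (Ω × D) => a p.2.1 (p.1 : F) :=
      h1.comp (measurable_fst.prodMk (measurable_fst.comp measurable_snd))
    have h4 : Measurable fun p : V × (Ω × D) => ev (p.1 : F) p.2.2 :=
      h2.comp (measurable_fst.prodMk (measurable_snd.comp measurable_snd))
    -- on the finite-dimensional span, function values depend on finitely many coordinates
    have h5 : Measurable fun p : V × (Ω × D) => ev (a p.2.1 (p.1 : F)) p.2.2 := by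
      have h6 : ∀ p : V × (Ω × D), ev (a p.2.1 (p.1 : F)) p.2.2 =
          ∑ i : Fin m, inner K (e i) (a p.2.1 (p.1 : F)) * ev (e i) p.2.2 := by
        intro p
        conv_lhs => rw [← hon.eq_sum_inner_smul_of_mem_span (hspan p.2.1 (p.1 : F))]
        simp
      simp only [h6]
      refine Finset.measurable_fun_sum _ fun i _ => ?_
      have h7 : Continuous fun g : F => inner K (e i) g := by fun_prop
      exact (h7.measurable.comp h3).mul
        ((hev (e i)).comp (measurable_snd.comp measurable_snd))
    refine h3.add ((Finset.measurable_fun_sum _ fun j _ => ?_).const_smul _)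
    refine Measurable.smul_const (Measurable.mul_const ?_ _) _
    unfold sampleCoeff
    have h8 : Measurable fun p : V × (Ω × D) => b j p.2.2 :=
      (hb j).comp (measurable_snd.comp measurable_snd)
    have h9 : Measurable fun p : V × (Ω × D) => samplingDensity b m p.2.2 :=
      (measurable_samplingDensity hb m).comp (measurable_snd.comp measurable_snd)
    refine Measurable.div (Measurable.mul ?_ (h4.sub h5)) ?_
    · exact RCLike.continuous_conj.measurable.comp h8
    · exact RCLike.continuous_ofReal.measurable.comp h9.coe_nnreal_real
  · have hTupd : ∀ ω x, T f - T (upd x (a ω f) (ev f x)) = T (f - a ω f) -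
        (m : K)⁻¹ • ∑ j : Fin m, sampleCoeff b m x (ev (f - a ω f) x) j • B j := by
      intro ω x
      simp only [upd, map_add, map_sub, map_smul, map_sum, hBdef, smul_smul, Pi.sub_apply]
      abel
    have hproj : ∀ ω, ‖T (f - a ω f)‖ ^ 2 - s m ^ 2 ≤
        ∑ j : Fin m, ‖inner K (B j) (T (f - a ω f))‖ ^ 2 := by
      intro ω
      have h1 := hS.norm_map_sub_sum_le m f
      have h2 : f - a ω f - ∑ i : Fin m, inner K (e i) (f - a ω f) • e i =
          f - ∑ i : Fin m, inner K (e i) f • e i := by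
        simp only [inner_sub_right, sub_smul, Finset.sum_sub_distrib]
        rw [hon.eq_sum_inner_smul_of_mem_span (hspan ω f)]
        abel
      have hBon : Orthonormal K fun i : Fin m => B i := hB.comp _ Fin.val_injective
      have h3 : T (f - a ω f - ∑ i : Fin m, inner K (e i) (f - a ω f) • e i) =
          T (f - a ω f) - ∑ i : Fin m, inner K (B i) (T (f - a ω f)) • B i := by
        rw [map_sub T, map_sum]
        congr 1
        refine Finset.sum_congr rfl fun i _ => ?_
        have hsi : ((s i : ℝ) : K) ≠ 0 := by exact_mod_cast (hS.pos i).ne'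
        rw [map_smul, hBdef, inner_smul_left, hS.inner_map_map, RCLike.conj_ofReal, smul_smul]
        congr 1
        push_cast
        field_simp
      have h4 : ‖T (f - a ω f) - ∑ i : Fin m, inner K (B i) (T (f - a ω f)) • B i‖ ^ 2 =
          ‖T (f - a ω f)‖ ^ 2 - ∑ j : Fin m, ‖inner K (B j) (T (f - a ω f))‖ ^ 2 := by
        rw [norm_sub_sq (𝕜 := K), hBon.norm_sum_smul_sq, inner_sum, map_sum]
        have : ∀ i : Fin m, RCLike.re (inner K (T (f - a ω f))
            (inner K (B i) (T (f - a ω f)) • B i)) = ‖inner K (B i) (T (f - a ω f))‖ ^ 2 := by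
          intro i
          rw [inner_smul_right, ← inner_conj_symm (T (f - a ω f)) (B i), RCLike.mul_conj,
            ← RCLike.ofReal_pow, RCLike.ofReal_re]
        simp only [this]
        ring
      rw [← h2, h3] at h1
      have h5 := pow_le_pow_left₀ (norm_nonneg _)
        (h1.trans (mul_le_of_le_one_right (hS.pos m).le hf)) 2
      linarith
    have hstep : ∀ ω, ∫⁻ x, ‖T f - T (upd x (a ω f) (ev f x))‖ₑ ^ 2 ∂Q ≤
        ENNReal.ofReal (1 - (m : ℝ)⁻¹) * ‖T f - T (a ω f)‖ₑ ^ 2 +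
          ENNReal.ofReal (2 * (m : ℝ)⁻¹ * s m ^ 2) := by
      intro ω
      simp only [hTupd]
      rw [hQdef]
      refine (lintegral_enorm_sub_sample_le hb hB hBb hm (hTev (f - a ω f))).trans ?_
      rw [← ofReal_norm, ← ENNReal.ofReal_pow (norm_nonneg _), ← ENNReal.ofReal_mul hm2,
        ← ENNReal.ofReal_add (by positivity) (by positivity), ← map_sub]
      refine ENNReal.ofReal_le_ofReal ?_
      have := mul_le_mul_of_nonneg_left (hproj ω) (show 0 ≤ 2 * (m : ℝ)⁻¹ by positivity)
      linarith
    calc ∫⁻ p, ‖T f - T (upd p.2 (a p.1 f) (ev f p.2))‖ₑ ^ 2 ∂(P.prod Q)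
        ≤ ∫⁻ ω, ∫⁻ x, ‖T f - T (upd x (a ω f) (ev f x))‖ₑ ^ 2 ∂Q ∂P := lintegral_prod_le _
      _ ≤ ∫⁻ ω, (ENNReal.ofReal (1 - (m : ℝ)⁻¹) * ‖T f - T (a ω f)‖ₑ ^ 2 +
          ENNReal.ofReal (2 * (m : ℝ)⁻¹ * s m ^ 2)) ∂P := lintegral_mono hstep
      _ = ENNReal.ofReal (1 - (m : ℝ)⁻¹) * (∫⁻ ω, ‖T f - T (a ω f)‖ₑ ^ 2 ∂P) +
          ENNReal.ofReal (2 * (m : ℝ)⁻¹ * s m ^ 2) := by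
        rw [lintegral_add_right _ measurable_const, lintegral_const_mul' _ _ ENNReal.ofReal_ne_top,
          lintegral_const, measure_univ, mul_one]
      _ ≤ ENNReal.ofReal (1 - (m : ℝ)⁻¹) * ENNReal.ofReal r +
          ENNReal.ofReal (2 * (m : ℝ)⁻¹ * s m ^ 2) := by
        gcongr
        exact herr f hf
      _ = _ := by
        rw [← ENNReal.ofReal_mul hm2, ← ENNReal.ofReal_add (by positivity) (by positivity)]

/-- With `ℓ * m` samples in a fixed dimension `m` the error contracts by the factor `exp (-ℓ)`. -/
theorem block [SecondCountableTopology F] (hS : SingularSystem T e s)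
    (hev : ∀ f, Measurable (ev f)) (hTev : ∀ f, T f =ᵐ[μ] ev f)
    (h : HasMonteCarlo ev T e n m r) (hm : 0 < m) (hr : 0 ≤ r) (ℓ : ℕ) :
    HasMonteCarlo ev T e (n + ℓ * m) m (Real.exp (-ℓ) * r + 2 * s m ^ 2) := by
  have hm1 : (1 : ℝ) ≤ m := Nat.one_le_cast.mpr hm
  have hm2 : 0 ≤ 1 - (m : ℝ)⁻¹ := sub_nonneg.mpr (inv_le_one_of_one_le₀ hm1)
  have h1 : ∀ N : ℕ, HasMonteCarlo ev T e (n + N) m ((1 - (m : ℝ)⁻¹) ^ N * r + 2 * s m ^ 2) := by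
    intro N
    induction N with
    | zero => exact h.mono le_rfl le_rfl (by nlinarith [sq_nonneg (s m)])
    | succ N ih =>
      refine (ih.step hS hev hTev hm (by positivity)).mono le_rfl le_rfl (le_of_eq ?_)
      ring
  refine (h1 (ℓ * m)).mono le_rfl le_rfl ?_
  gcongr
  have h2 : 1 - (m : ℝ)⁻¹ ≤ Real.exp (-(m : ℝ)⁻¹) := by
    linarith [Real.add_one_le_exp (-(m : ℝ)⁻¹)]
  calc (1 - (m : ℝ)⁻¹) ^ (ℓ * m) ≤ Real.exp (-(m : ℝ)⁻¹) ^ (ℓ * m) := pow_le_pow_left₀ hm2 h2 _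
    _ = Real.exp (-ℓ) := by
      rw [← Real.exp_nat_mul]
      congr 1
      push_cast
      field_simp

end HasMonteCarlo

end

/-! ### Doubling sequences and the order of convergence -/

theorem exists_le_mul_pow_two_mul {s : ℕ → ℝ} {C : ℝ} (hC : 0 < C) {n₀ : ℕ}
    (h : ∀ n ≥ n₀, s n ≤ C * s (2 * n)) (p : ℕ) : ∀ n ≥ n₀, s n ≤ C ^ p * s (2 ^ p * n) := by
  induction p with
  | zero => intro n _; simp
  | succ p ih =>
    intro n hn
    refine (ih n hn).trans ?_
    have h1 := h (2 ^ p * n) (hn.trans (Nat.le_mul_of_pos_left n (by positivity)))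
    calc C ^ p * s (2 ^ p * n) ≤ C ^ p * (C * s (2 * (2 ^ p * n))) := by gcongr
      _ = C ^ (p + 1) * s (2 ^ (p + 1) * n) := by
        rw [show 2 * (2 ^ p * n) = 2 ^ (p + 1) * n by ring]; ring

namespace SingularSystem

variable {D : Type u} [MeasurableSpace D] {μ : Measure D} {K : Type w} [RCLike K]
    {F : Type v} [NormedAddCommGroup F] [InnerProductSpace K F] [CompleteSpace F]
    {e : ℕ → F} {s : ℕ → ℝ}

theorem exists_doubling {G : Type*} [NormedAddCommGroup G] [InnerProductSpace K G]
    [CompleteSpace G] {T : F →L[K] G} (hS : SingularSystem T e s)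
    (hσ : OrderLE (fun n => ENNReal.ofReal (nthSingularValue T n))
      (fun n => ENNReal.ofReal (nthSingularValue T (2 * n)))) :
    ∃ C : ℝ, 0 < C ∧ ∃ n₀ : ℕ, ∀ n ≥ n₀, s n ≤ C * s (2 * n) := by
  obtain ⟨C, hC, n₀, h⟩ := hσ
  refine ⟨C, hC, n₀, fun n hn => ?_⟩
  have h1 := h (n + 1) (by omega)
  beta_reduce at h1
  rw [hS.nthSingularValue_succ, show 2 * (n + 1) = 2 * n + 1 + 1 by ring, hS.nthSingularValue_succ,
    ← ENNReal.ofReal_coe_nnreal, ← ENNReal.ofReal_mul NNReal.zero_le_coe,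
    ENNReal.ofReal_le_ofReal_iff (mul_nonneg NNReal.zero_le_coe (hS.pos _).le)] at h1
  have hC' : (0 : ℝ) ≤ C := NNReal.zero_le_coe
  exact h1.trans (mul_le_mul_of_nonneg_left (hS.antitone (by omega)) hC')

/-- If the singular values do not decay faster than polynomially, then the number of samples per
block can be chosen such that the contraction of the error in each block beats the decay of the
singular values. -/
theorem exists_hasMonteCarlo [SecondCountableTopology F] {T : F →L[K] Lp K 2 μ}
    (hS : SingularSystem T e s) {ev : F →ₗ[K] (D → K)} (hev : ∀ f, Measurable (ev f))
    (hTev : ∀ f, T f =ᵐ[μ] ev f) {C : ℝ} (hC : 0 < C) {n₀ : ℕ}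
    (hd : ∀ n ≥ n₀, s n ≤ C * s (2 * n)) :
    ∃ ℓ : ℕ, 0 < ℓ ∧ ∃ A : ℝ, 0 < A ∧ ∀ j ≥ n₀,
      HasMonteCarlo ev T e (ℓ * 2 ^ j) (2 ^ j) ((A * s (2 ^ j)) ^ 2) := by
  -- `ℓ` is chosen such that `exp (-ℓ) * C ^ 2 ≤ 1 / 2`
  obtain ⟨ℓ, hℓ⟩ := exists_nat_gt (2 * C ^ 2)
  have hℓ0 : 0 < ℓ := by
    have : (0 : ℝ) < ℓ := lt_of_le_of_lt (by positivity) hℓ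
    exact_mod_cast this
  have hexp : Real.exp (-ℓ) * C ^ 2 ≤ 1 / 2 := by
    have h1 : (ℓ : ℝ) ≤ Real.exp ℓ := by linarith [Real.add_one_le_exp (ℓ : ℝ)]
    rw [Real.exp_neg, inv_mul_le_iff₀ (Real.exp_pos _)]
    linarith
  have hs := hS.pos
  let A : ℝ := s 0 / s (2 ^ n₀) + 2 * C
  have hA : 0 < A := add_pos (div_pos (hs _) (hs _)) (by positivity)
  refine ⟨ℓ, hℓ0, A, hA, fun j hj => ?_⟩
  induction j, hj using Nat.le_induction with
  | base =>
    refine (HasMonteCarlo.zero (c := s 0) (fun f => hS.norm_le 0 f (by simp)) (hs 0).le).mono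
      (Nat.zero_le _) (Nat.zero_le _) (pow_le_pow_left₀ (hs 0).le ?_ 2)
    calc s 0 = s 0 / s (2 ^ n₀) * s (2 ^ n₀) := (div_mul_cancel₀ _ (hs _).ne').symm
      _ ≤ _ := mul_le_mul_of_nonneg_right (le_add_of_nonneg_right (by positivity)) (hs _).le
  | succ j hj ih =>
    refine (ih.block hS hev hTev (by positivity) (by positivity) ℓ).mono (le_of_eq (by ring))
      (Nat.pow_le_pow_right (by norm_num) (by omega)) ?_
    have h1 : s (2 ^ j) ≤ C * s (2 ^ (j + 1)) := by
      rw [pow_succ']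
      exact hd _ (le_trans hj Nat.lt_two_pow_self.le)
    have h2 : s (2 ^ j) ^ 2 ≤ C ^ 2 * s (2 ^ (j + 1)) ^ 2 := by
      rw [← mul_pow]
      exact pow_le_pow_left₀ (hs _).le h1 2
    have h3 : 4 * C ^ 2 ≤ A ^ 2 := by
      have : 2 * C ≤ A := le_add_of_nonneg_left (div_pos (hs _) (hs _)).le
      nlinarith
    calc Real.exp (-ℓ) * (A * s (2 ^ j)) ^ 2 + 2 * s (2 ^ j) ^ 2
        = (Real.exp (-ℓ) * A ^ 2 + 2) * s (2 ^ j) ^ 2 := by ring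
      _ ≤ (Real.exp (-ℓ) * A ^ 2 + 2) * (C ^ 2 * s (2 ^ (j + 1)) ^ 2) := by gcongr
      _ = (Real.exp (-ℓ) * C ^ 2 * A ^ 2 + 2 * C ^ 2) * s (2 ^ (j + 1)) ^ 2 := by ring
      _ ≤ (1 / 2 * A ^ 2 + 2 * C ^ 2) * s (2 ^ (j + 1)) ^ 2 := by gcongr
      _ ≤ A ^ 2 * s (2 ^ (j + 1)) ^ 2 := by gcongr; linarith
      _ = (A * s (2 ^ (j + 1))) ^ 2 := by ring

theorem exists_minRanError_le [SecondCountableTopology F] {T : F →L[K] Lp K 2 μ}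
    (hS : SingularSystem T e s) {ev : F →ₗ[K] (D → K)} (hev : ∀ f, Measurable (ev f))
    (hTev : ∀ f, T f =ᵐ[μ] ev f) {C : ℝ} (hC : 0 < C) {n₀ : ℕ}
    (hd : ∀ n ≥ n₀, s n ≤ C * s (2 * n)) :
    ∃ c : ℝ, 0 < c ∧ ∃ n₁ : ℕ, ∀ n ≥ n₁,
      minRanError T ev (lambdaStd ev) n ≤ ENNReal.ofReal (c * s (4 * n)) := by
  obtain ⟨ℓ, hℓ, A, hA, h⟩ := hS.exists_hasMonteCarlo hev hTev hC hd
  have hs := hS.pos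
  -- `p` doublings lead from `2 ^ j`, the dimension used with `n` samples, to `4 * n`
  obtain ⟨p, hp⟩ : ∃ p : ℕ, 8 * ℓ ≤ 2 ^ p := ⟨8 * ℓ, Nat.lt_two_pow_self.le⟩
  refine ⟨A * C ^ p, by positivity, ℓ * 2 ^ n₀, fun n hn => ?_⟩
  have hnℓ : n / ℓ ≠ 0 := by
    have : 1 ≤ n / ℓ := (Nat.le_div_iff_mul_le hℓ).mpr (by nlinarith [Nat.one_le_two_pow (n := n₀)])
    omega
  obtain ⟨j, hj⟩ : ∃ j, j = Nat.log 2 (n / ℓ) := ⟨_, rfl⟩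
  have hj1 : 2 ^ j ≤ n / ℓ := hj ▸ Nat.pow_log_le_self 2 hnℓ
  have hj2 : n / ℓ < 2 ^ (j + 1) := hj ▸ Nat.lt_pow_succ_log_self (by norm_num) _
  have hj0 : n₀ ≤ j := by
    rw [hj]
    refine (Nat.le_log_iff_pow_le (by norm_num) hnℓ).mpr ?_
    rw [Nat.le_div_iff_mul_le hℓ, mul_comm]
    exact hn
  have hjn : ℓ * 2 ^ j ≤ n := by
    rw [mul_comm]
    exact (Nat.le_div_iff_mul_le hℓ).mp hj1
  have hnj : 4 * n ≤ 2 ^ p * 2 ^ j := by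
    have h1 : n < 2 ^ (j + 1) * ℓ := (Nat.div_lt_iff_lt_mul hℓ).mp hj2
    calc 4 * n ≤ 8 * ℓ * 2 ^ j := by rw [pow_succ] at h1; nlinarith
      _ ≤ _ := Nat.mul_le_mul_right _ hp
  refine (((h j hj0).mono hjn le_rfl le_rfl).minRanError_le (mul_pos hA (hs _)).le).trans
    (ENNReal.ofReal_le_ofReal ?_)
  have h1 := exists_le_mul_pow_two_mul hC hd p (2 ^ j) (hj0.trans Nat.lt_two_pow_self.le)
  calc A * s (2 ^ j) ≤ A * (C ^ p * s (2 ^ p * 2 ^ j)) := by gcongr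
    _ ≤ A * (C ^ p * s (4 * n)) := by gcongr; exact hS.antitone hnj
    _ = _ := by ring

end SingularSystem

theorem OrderLE.of_le {x y : ℕ → ℝ≥0∞} {n₀ : ℕ} (h : ∀ n ≥ n₀, x n ≤ y n) : OrderLE x y :=
  ⟨1, one_pos, n₀, fun n hn => by simpa using h n hn⟩

theorem OrderLE.trans {x y z : ℕ → ℝ≥0∞} (hxy : OrderLE x y) (hyz : OrderLE y z) : OrderLE x z := by
  obtain ⟨C, hC, n₀, h⟩ := hxy
  obtain ⟨C', hC', n₁, h'⟩ := hyz
  refine ⟨C * C', mul_pos hC hC', max n₀ n₁, fun n hn => ?_⟩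
  refine (h n (le_of_max_le_left hn)).trans ?_
  rw [ENNReal.coe_mul, mul_assoc]
  gcongr
  exact h' n (le_of_max_le_right hn)

theorem OrderLE.of_le_ofReal_mul {x : ℕ → ℝ≥0∞} {t : ℕ → ℝ} {c : ℝ} (hc : 0 < c) {n₀ : ℕ}
    (h : ∀ n ≥ n₀, x n ≤ ENNReal.ofReal (c * t n)) : OrderLE x fun n => ENNReal.ofReal (t n) :=
  ⟨c.toNNReal, Real.toNNReal_pos.mpr hc, n₀, fun n hn => by
    have := h n hn
    rwa [ENNReal.ofReal_mul hc.le] at this⟩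

/-! ### Spaces of finite dimension -/

/-- On a finite-dimensional space of functions, finitely many function values determine the
function, since point evaluations span the dual space. Every map is then computed exactly. -/
theorem exists_isDetAlg_lambdaStd_eq {D : Type u} {K : Type w} [RCLike K] {F : Type v}
    [AddCommGroup F] [Module K F] [FiniteDimensional K F] {ev : F →ₗ[K] (D → K)}
    (hinj : Function.Injective ev) {G : Type*} (T : F → G) :
    ∃ n₀, ∀ n ≥ n₀, IsDetAlg (lambdaStd ev) n T := by
  let S : Set (Module.Dual K F) := Set.range fun x : D => (LinearMap.proj x).comp ev
  obtain ⟨L, hLS, hLspan, -⟩ := Submodule.exists_fun_fin_finrank_span_eq K S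
  have hker : LinearMap.ker (LinearMap.pi L) = ⊥ := by
    rw [LinearMap.ker_eq_bot']
    intro f hf
    have h1 : ∀ M ∈ Submodule.span K S, M f = 0 := by
      intro M hM
      rw [← hLspan] at hM
      induction hM using Submodule.span_induction with
      | mem M hM => obtain ⟨i, rfl⟩ := hM; exact congrFun hf i
      | zero => rfl
      | add M N _ _ hM hN => rw [LinearMap.add_apply, hM, hN, add_zero]
      | smul c M _ hM => rw [LinearMap.smul_apply, hM, smul_zero]
    refine hinj ?_
    rw [map_zero]
    exact funext fun x => h1 _ (Submodule.subset_span ⟨x, rfl⟩)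
  obtain ⟨R, hR⟩ := LinearMap.exists_leftInverse_of_injective _ hker
  refine ⟨Module.finrank K (Submodule.span K S), fun n hn => IsDetAlg.mono ?_ subset_rfl hn⟩
  have h1 := IsDetAlg.of_values (Λ := lambdaStd ev) L (fun i => by
    obtain ⟨x, hx⟩ := hLS i
    exact ⟨x, fun f => by rw [← hx]; rfl⟩) fun y => T (R y)
  have h2 : (fun f => T (R fun i => L i f)) = T := by
    ext f
    exact congrArg T (LinearMap.congr_fun hR f)
  rwa [h2] at h1

/-! ### The order of the minimal errors -/

theorem mainTheorem3 {D : Type u} [MeasurableSpace D] (μ : Measure D)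
    {K : Type w} [RCLike K]
    {F : Type v} [NormedAddCommGroup F] [InnerProductSpace K F] [CompleteSpace F]
    -- `F` is a space of measurable functions on `D`: the element `f` is the function `ev f`
    (ev : F →ₗ[K] (D → K)) (hev : ∀ f, Measurable (ev f))
    -- the embedding of `F` into `L²` is well-defined, injective and compact
    (T : F →L[K] Lp K 2 μ) (hTev : ∀ f, T f =ᵐ[μ] ev f)
    (hTinj : Function.Injective T) (hTcpt : IsCompactOperator T)
    (hσ : SameOrder (fun n => ENNReal.ofReal (nthSingularValue T (2 * n)))
      (fun n => ENNReal.ofReal (nthSingularValue T n))) :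
    SameOrder (minRanError T ev (lambdaStd ev)) (minRanError T ev (lambdaAll K F)) ∧
      SameOrder (minRanError T ev (lambdaAll K F)) (minDetError T (lambdaAll K F)) := by
  have hall_std : OrderLE (minRanError T ev (lambdaAll K F)) (minRanError T ev (lambdaStd ev)) :=
    OrderLE.of_le (n₀ := 0) fun n _ => minRanError_mono_class (Set.subset_univ _)
  by_cases hF : FiniteDimensional K F
  · have hevinj : Function.Injective ev := by
      intro f g hfg
      refine hTinj (Lp.ext ?_)
      filter_upwards [hTev f, hTev g] with x hf hg
      rw [hf, hg, hfg]
    obtain ⟨n₀, hn₀⟩ := exists_isDetAlg_lambdaStd_eq hevinj T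
    have h0 : detError T T = 0 := by simp [detError]
    have hstd : ∀ n ≥ n₀, minRanError T ev (lambdaStd ev) n = 0 := fun n hn =>
      le_antisymm ((minRanError_le_detError (hn₀ n hn) T.continuous).trans h0.le) zero_le
    have hall : ∀ n ≥ n₀, minRanError T ev (lambdaAll K F) n = 0 := fun n hn =>
      le_antisymm ((minRanError_mono_class (Set.subset_univ _)).trans (hstd n hn).le) zero_le
    have hdet : ∀ n ≥ n₀, minDetError T (lambdaAll K F) n = 0 := fun n hn =>
      le_antisymm (iInf₂_le_of_le T ((hn₀ n hn).mono (Set.subset_univ _) le_rfl) h0.le) zero_le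
    exact ⟨⟨OrderLE.of_le fun n hn => (hstd n hn).trans_le zero_le, hall_std⟩,
      OrderLE.of_le fun n hn => (hall n hn).trans_le zero_le,
      OrderLE.of_le fun n hn => (hdet n hn).trans_le zero_le⟩
  · obtain ⟨e, s, hS⟩ := exists_singularSystem T hTinj hTcpt hF
    have := secondCountableTopology_of_injective_of_isCompactOperator T hTinj hTcpt
    obtain ⟨C, hC, n₀, hd⟩ := hS.exists_doubling hσ.2
    obtain ⟨c, hc, n₁, hstd⟩ := hS.exists_minRanError_le hev hTev hC hd
    have hlow : OrderLE (fun n => ENNReal.ofReal (s (4 * n))) (minRanError T ev (lambdaAll K F)) :=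
      ⟨3, by norm_num, 1, fun n hn => hS.le_minRanError ev _ hn⟩
    have hdbl : OrderLE (fun n => ENNReal.ofReal (s n)) fun n => ENNReal.ofReal (s (4 * n)) :=
      OrderLE.of_le_ofReal_mul (pow_pos hC 2) fun n hn =>
        ENNReal.ofReal_le_ofReal (exists_le_mul_pow_two_mul hC hd 2 n hn)
    refine ⟨⟨(OrderLE.of_le_ofReal_mul hc hstd).trans hlow, hall_std⟩, ?_, ?_⟩
    · exact OrderLE.of_le (n₀ := 0) fun n _ =>
        (hS.minRanError_le ev n).trans (hS.le_minDetError _ n)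
    · exact (OrderLE.of_le (n₀ := 0) fun n _ => hS.minDetError_le n).trans (hdbl.trans hlow)
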